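/- **Theorem B.2.** A function $A:\mathbb R\to\mathbb R$ is called *admissible* if $A\in C^\infty(\mathbb R)$, $A>0$, and there are $x_+>x_->0$ and $A_\infty>0$ such that $A(x)=1$ for $x<x_-$ and $A(x)=A_\infty$ for $x>x_+$. Put $\square_A u=\partial_t^2u-\frac1A\partial_x(A\,\partial_xu)$ for $u\in\mathcal D'(\mathbb R^2)$, where the coordinates of $\mathbb R^2$ are $(x,t)$; let $\Sigma=\{(x,t,\xi_x,\xi_t):(\xi_x,\xi_t)\ne0,\ \xi_t^2=\xi_x^2\}$ and let $\mathcal D'_\Sigma(\mathbb R^2)$ be the space of distributions $u\in\mathcal D'(\mathbb R^2)$ whose wave front set is contained in $\Sigma$. Give it the topology generated by that of $\mathcal D'(\mathbb R^2)$ and the seminorms $u\mapsto\sup_{\xi\in\Gamma}|\xi|^N|\widehat{\phi u}(\xi)|$ ($N\in\mathbb N$, $\phi\in C_c^\infty(\mathbb R^2)$, $\Gamma\subset\mathbb R^2$ a closed cone with $(\operatorname{supp}\phi\times\Gamma)\cap\Sigma=\emptyset$). The trace $u\mapsto u|_{x=0}$ is the sequentially continuous extension $\mathcal D'_\Sigma(\mathbb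 R^2)\to\mathcal D'(\mathbb R)$ of the restriction $v\mapsto v(0,\cdot)$ of smooth functions. For $f\in\mathcal D'(\mathbb R)$ with $\operatorname{supp} f\subset(t_0,\infty)$ for some $t_0\in\mathbb R$, the *Neumann-to-Dirichlet map* of $A$ is $\Lambda_A f=u|_{x=0}$, where $u\in\mathcal D'_\Sigma(\mathbb R^2)$ satisfies $$\square_Au=0\ \text{ in }(0,\infty)\times\mathbb R,\qquad u=0\ \text{ in }(0,\infty)\times(-\infty,t_0),\qquad \partial_xu|_{x=0}=f .$$ (Such a $u$ exists and is unique in $(0,\infty)\times\mathbb R$, and $\Lambda_Af$ depends neither on the choice of $u$ nor on that of $t_0$.) Let $A_1,A_2$ be admissible. If $\Lambda_{A_1}f=\Lambda_{A_2}f$ for every compactly supported distribution $f\in\mathcal E'(\mathbb R)$, then $A_1=A_2$ on $\mathbb R$. -/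

import Mathlib

open scoped Distributions ContDiff LineDeriv Topology CompactConvergenceCLM

noncomputable section

namespace WaveND

/-- `A : ℝ → ℝ` is admissible: smooth, strictly positive, equal to `1` to the left of some `x₋ > 0`
and equal to a positive constant `A∞` to the right of some `x₊ > x₋`. -/
structure Admissible (A : ℝ → ℝ) : Prop where
  smooth : ContDiff ℝ ∞ A
  pos : ∀ x, 0 < A x
  ends : ∃ xm xp Ainf : ℝ, 0 < xm ∧ xm < xp ∧ 0 < Ainf ∧
    (∀ x, x < xm → A x = 1) ∧ (∀ x, xp < x → A x = Ainf)

/-- Complex distributions on the line (the time axis). -/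
abbrev Dist1 := 𝓓'((⊤ : TopologicalSpace.Opens ℝ), ℂ)

/-- Complex distributions on the plane; a point is written `(x, t)`. -/
abbrev Dist2 := 𝓓'((⊤ : TopologicalSpace.Opens (ℝ × ℝ)), ℂ)

/-! ### Multiplication by smooth functions -/

section Mul

variable {E : Type*} [NormedAddCommGroup E] [NormedSpace ℝ E] {Ω : TopologicalSpace.Opens E}

/-- The product `a φ` of a test function `φ` with a smooth function `a`. -/
def mulTest (a : E → ℝ) (ha : ContDiff ℝ ∞ a) (φ : 𝓓(Ω, ℝ)) : 𝓓(Ω, ℝ) where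
  toFun x := a x * φ x
  contDiff' := ha.mul φ.contDiff
  hasCompactSupport' := φ.hasCompactSupport.mul_left
  tsupport_subset' := (tsupport_mul_subset_right (f := a) (g := φ)).trans φ.tsupport_subset

/-- Multiplication of test functions by a smooth function, as a continuous linear map. -/
def mulTestCLM (a : E → ℝ) (ha : ContDiff ℝ ∞ a) : 𝓓(Ω, ℝ) →L[ℝ] 𝓓(Ω, ℝ) :=
  TestFunction.limitCLM ℝ (mulTest a ha)
    (fun _ hK ↦ (TestFunction.ofSupportedInCLM ℝ hK).comp
      (ContDiffMapSupportedIn.bilinLeftCLM (ContinuousLinearMap.mul ℝ ℝ) ha))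
    (fun _ _ f ↦ by ext x; simp [mulTest, mul_comm])

/-- The product `a u` of a distribution `u` with a smooth function `a`:
`⟨a u, φ⟩ = ⟨u, a φ⟩`. -/
def mulDist (a : E → ℝ) (ha : ContDiff ℝ ∞ a) : 𝓓'(Ω, ℂ) →L[ℝ] 𝓓'(Ω, ℂ) :=
  (mulTestCLM a ha).precompCompactConvergenceCLM _

theorem mulDist_apply (a : E → ℝ) (ha : ContDiff ℝ ∞ a) (u : 𝓓'(Ω, ℂ)) (φ : 𝓓(Ω, ℝ)) :
    mulDist a ha u φ = u (mulTest a ha φ) := rfl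

end Mul

/-! ### The distribution given by a function -/

/-- The distribution `φ ↦ ∫ φ v` given by a function `v` (used below for smooth `v` only). -/
def ofFun {E : Type*} [NormedAddCommGroup E] [NormedSpace ℝ E] [MeasureTheory.MeasureSpace E]
    [OpensMeasurableSpace E] (v : E → ℂ) : 𝓓'((⊤ : TopologicalSpace.Opens E), ℂ) :=
  (TestFunction.integralAgainstBilinCLM (ContinuousLinearMap.lsmul ℝ ℝ)
    MeasureTheory.volume v : 𝓓((⊤ : TopologicalSpace.Opens E), ℝ) →L[ℝ] ℂ)

theorem ofFun_apply {E : Type*} [NormedAddCommGroup E] [NormedSpace ℝ E]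
    [MeasureTheory.MeasureSpace E] [OpensMeasurableSpace E]
    [MeasureTheory.IsLocallyFiniteMeasure (MeasureTheory.volume : MeasureTheory.Measure E)]
    [SecondCountableTopology E]
    {v : E → ℂ} (hv : Continuous v) (φ : 𝓓((⊤ : TopologicalSpace.Opens E), ℝ)) :
    ofFun v φ = ∫ x, φ x • v x :=
  TestFunction.integralAgainstBilinCLM_eq_integral
    (hv.locallyIntegrable.locallyIntegrableOn _)

/-! ### The wave operator -/

/-- The derivative of a distribution in `x`. -/
def dx (u : Dist2) : Dist2 := ∂_{((1 : ℝ), (0 : ℝ))} u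

/-- The derivative of a distribution in `t`. -/
def dt (u : Dist2) : Dist2 := ∂_{((0 : ℝ), (1 : ℝ))} u

theorem Admissible.smooth_fst {A : ℝ → ℝ} (hA : Admissible A) :
    ContDiff ℝ ∞ (fun p : ℝ × ℝ ↦ A p.1) :=
  hA.smooth.comp contDiff_fst

theorem Admissible.smooth_inv_fst {A : ℝ → ℝ} (hA : Admissible A) :
    ContDiff ℝ ∞ (fun p : ℝ × ℝ ↦ (A p.1)⁻¹) :=
  hA.smooth_fst.inv fun p ↦ (hA.pos p.1).ne'

/-- The wave operator `□_A u = ∂ₜ² u - A⁻¹ ∂ₓ (A ∂ₓ u)` on distributions. -/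
def waveOp {A : ℝ → ℝ} (hA : Admissible A) (u : Dist2) : Dist2 :=
  dt (dt u) - mulDist _ hA.smooth_inv_fst (dx (mulDist _ hA.smooth_fst (dx u)))

/-! ### Wave front sets -/

/-- The phase `⟨ξ, z⟩`, where `ξ = (ξₓ, ξₜ)` and `z = (x, t)`. -/
def phase (ξ z : ℝ × ℝ) : ℝ := ξ.1 * z.1 + ξ.2 * z.2

theorem contDiff_phase (ξ : ℝ × ℝ) : ContDiff ℝ ∞ (phase ξ) := by
  unfold phase; fun_prop

/-- The Euclidean length of a covector. -/
def covNorm (ξ : ℝ × ℝ) : ℝ := √(ξ.1 ^ 2 + ξ.2 ^ 2)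

/-- The Fourier transform of the compactly supported distribution `φ u`, that is
`ξ ↦ ⟨u, φ e^{-i⟨ξ, ·⟩}⟩`; the test function is split into real and imaginary part. -/
def localFourier (φ : 𝓓((⊤ : TopologicalSpace.Opens (ℝ × ℝ)), ℝ)) (u : Dist2) (ξ : ℝ × ℝ) : ℂ :=
  u (mulTest (fun z ↦ Real.cos (phase ξ z)) (contDiff_phase ξ).cos φ)
    - Complex.I * u (mulTest (fun z ↦ Real.sin (phase ξ z)) (contDiff_phase ξ).sin φ)

/-- A set of covectors is conic if it is stable under multiplication by positive numbers. -/
def IsConic (V : Set (ℝ × ℝ)) : Prop := ∀ r : ℝ, 0 < r → ∀ ξ ∈ V, r • ξ ∈ V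

/-- The wave front set: the pairs `(z, ξ)` with `ξ ≠ 0` for which there are no test function `φ`
with `φ z ≠ 0` and open conic neighbourhood `V` of `ξ` such that the Fourier transform of `φ u`
decays rapidly in `V`. -/
def waveFront (u : Dist2) : Set ((ℝ × ℝ) × (ℝ × ℝ)) :=
  {q | q.2 ≠ 0 ∧ ¬ ∃ (φ : 𝓓((⊤ : TopologicalSpace.Opens (ℝ × ℝ)), ℝ)) (V : Set (ℝ × ℝ)),
    φ q.1 ≠ 0 ∧ IsOpen V ∧ IsConic V ∧ (0 : ℝ × ℝ) ∉ V ∧ q.2 ∈ V ∧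
    ∀ N : ℕ, ∃ C : ℝ, ∀ ξ ∈ V, √(1 + covNorm ξ ^ 2) ^ N * ‖localFourier φ u ξ‖ ≤ C}

/-- The characteristic variety `Σ = {ξₜ² = ξₓ², ξ ≠ 0}` of the wave operator. -/
def charVariety : Set ((ℝ × ℝ) × (ℝ × ℝ)) := {q | q.2 ≠ 0 ∧ q.2.2 ^ 2 = q.2.1 ^ 2}

/-- The space `𝓓'_Σ(ℝ²)` of the distributions with wave front set in `Σ`. -/
def DSigma : Set Dist2 := {u | waveFront u ⊆ charVariety}

/-- Convergence of a sequence `v j → u` in `𝓓'_Σ(ℝ²)`: weak convergence, together with convergence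
in all the seminorms `sup_{ξ ∈ Γ} |ξ|^N |(φ u)^(ξ)|`, where `φ` is a test function and `Γ` is a
closed cone such that `supp φ × Γ` is disjoint from `Σ`. -/
def TendstoDSigma (v : ℕ → Dist2) (u : Dist2) : Prop :=
  (∀ φ : 𝓓((⊤ : TopologicalSpace.Opens (ℝ × ℝ)), ℝ),
    Filter.Tendsto (fun j ↦ v j φ) Filter.atTop (𝓝 (u φ))) ∧
  ∀ (N : ℕ) (φ : 𝓓((⊤ : TopologicalSpace.Opens (ℝ × ℝ)), ℝ)) (Γ : Set (ℝ × ℝ)),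
    IsClosed Γ → IsConic Γ → Disjoint (tsupport φ ×ˢ Γ) charVariety →
    ∀ ε : ℝ, 0 < ε → ∀ᶠ j in Filter.atTop, ∀ ξ ∈ Γ,
      covNorm ξ ^ N * ‖localFourier φ (u - v j) ξ‖ ≤ ε

/-! ### The boundary trace and the Neumann-to-Dirichlet map -/

/-- `g` is the boundary trace `u|_{x = 0}`. The trace on `𝓓'_Σ(ℝ²)` is the sequentially continuous
extension of the restriction `v ↦ v(0, ·)` of smooth functions: `g` is the limit in `𝓓'(ℝ)` of
`v j (0, ·)` for some smooth functions `v j` that converge to `u` in `𝓓'_Σ(ℝ²)`. -/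
def IsBoundaryTrace (u : Dist2) (g : Dist1) : Prop :=
  ∃ v : ℕ → ℝ × ℝ → ℂ, (∀ j, ContDiff ℝ ∞ (v j)) ∧
    TendstoDSigma (fun j ↦ ofFun (v j)) u ∧
    ∀ ψ : 𝓓((⊤ : TopologicalSpace.Opens ℝ), ℝ),
      Filter.Tendsto (fun j ↦ ofFun (fun t ↦ v j (0, t)) ψ) Filter.atTop (𝓝 (g ψ))

/-- `u ∈ 𝓓'_Σ(ℝ²)` solves the initial-boundary value problem `□_A u = 0` in `(0, ∞) × ℝ`,
`u = 0` in `(0, ∞) × (-∞, t₀)`, `∂ₓ u|_{x = 0} = f`. -/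
structure IsNeumannSolution {A : ℝ → ℝ} (hA : Admissible A) (t₀ : ℝ) (f : Dist1) (u : Dist2) :
    Prop where
  mem_DSigma : u ∈ DSigma
  wave : Distribution.IsVanishingOn (waveOp hA u) {p : ℝ × ℝ | 0 < p.1}
  initial : Distribution.IsVanishingOn u {p : ℝ × ℝ | 0 < p.1 ∧ p.2 < t₀}
  neumann : IsBoundaryTrace (dx u) f

/-- `g = u|_{x = 0}` for a solution `u` with Neumann data `f` and some `t₀` to the left of the
support of `f`. -/
def IsNDPair {A : ℝ → ℝ} (hA : Admissible A) (f g : Dist1) : Prop :=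
  ∃ (t₀ : ℝ) (u : Dist2), Distribution.dsupport f ⊆ Set.Ioi t₀ ∧
    IsNeumannSolution hA t₀ f u ∧ IsBoundaryTrace u g

open scoped Classical in
/-- The Neumann-to-Dirichlet map `f ↦ u|_{x = 0}`. The problem is uniquely solvable in `x > 0` if
the support of `f` is bounded from below; the value `0` is a default for all other `f`. -/
def neumannToDirichlet {A : ℝ → ℝ} (hA : Admissible A) (f : Dist1) : Dist1 :=
  if h : ∃ g, IsNDPair hA f g then h.choose else 0

/-- The space `𝓔'(ℝ)` of compactly supported distributions. -/
def compactlySupported : Set Dist1 := {f | IsCompact (Distribution.dsupport f)}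

end WaveND

end

/-!
The coefficient is read off from the impulse response of the half line. Put `c = A' / (2A)` and
split a solution of `□_A u = 0` into the right- and left-going components
`p = √A (∂ₜ - ∂ₓ) u / 2` and `r = √A (∂ₜ + ∂ₓ) u / 2`, for which the equation becomes the symmetric
system `(∂ₜ + ∂ₓ) p = c r`, `(∂ₜ - ∂ₓ) r = -c p`. The response to a boundary impulse is `-δ(t - x)`
in `p`, followed by continuous tails `P`, `R` behind the wave front (`IsKernel`, written in the
retarded time `τ = t - x`); along the front, `2 R(x, 0) = c(x)`.

* Existence (`exists_isKernel`) is a fixed point of a Volterra operator, contracting in an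
  exponentially weighted norm. All other solutions are superpositions in time of the impulse
  response. For these, differentiation in `t` falls on the source, and the system trades derivatives
  in `x` for derivatives in `t`; hence smooth sources give smooth solutions
  (`Admissible.exists_isWave`), to which the definition of the Neumann-to-Dirichlet map applies
  directly (`IsWave.isNDPair`).
* The value of the Neumann-to-Dirichlet map is known only as the trace `g` of some distributional
  solution `u`. The codirections `(s, 0)` are not characteristic, so convergence in `𝓓'_Σ` makes the
  integrals of `φ u` over the lines `x = const` a continuous function of `x`, and its value at
  `x = 0` is the trace (`IsBoundaryTrace.exists_lineMean`). Green's identity between `u` and a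
  smooth solution `w` of the time-reversed problem, first for a cutoff of `x > 0` and then in
  the limit, therefore reads `⟨g, ∂ₓw|ₓ₌₀⟩ = ⟨f, w|ₓ₌₀⟩` (`IsNeumannSolution.green`,
  `IsNDPair.pairing`).
  With the existence of enough `f` and `w`, equality of the two maps gives `R₁(0, ·) = R₂(0, ·)`
  (`kernel_boundary_eq`).
* The system evolves the difference of two impulse responses in the direction of `x`, starting from
  the common boundary values. The forcing contains `c₁ - c₂`, which the relation on the front
  expresses by the difference itself, so Gronwall's argument on the triangle `0 ≤ x ≤ X`,
  `0 ≤ τ ≤ 2 (X - x)` shows that `c₁ = c₂` (`IsKernel.coeff_eq`). Together with `A = 1` near `x = 0`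
  this determines `A`.
-/

namespace WaveND

open MeasureTheory intervalIntegral

/-! ### The impulse response -/

/-- The tails `P` (right-going) and `R` (left-going) of the impulse response behind the wave front,
as functions of `x` and the retarded time `τ = t - x ≥ 0`. `eq_R` integrates the first-order system
along a left-going characteristic back to the wave front, where `R = c / 2`; `eq_P` integrates it
along a right-going characteristic back to `x = 0`, where the Neumann condition reads `P = R`. The
values at `τ < 0` have no meaning; imposing `eq_R` there too lets `R` be differentiated along
left-going characteristics at `τ = 0`. -/
structure IsKernel (c : ℝ → ℝ) (P R : ℝ → ℝ → ℝ) : Prop where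
  cont_P : Continuous (Function.uncurry P)
  cont_R : Continuous (Function.uncurry R)
  eq_R : ∀ x τ, R x τ = c (x + τ / 2) / 2 - ∫ y in x..(x + τ / 2), c y * P y (τ + 2 * x - 2 * y)
  eq_P : ∀ x τ, 0 ≤ τ → P x τ = R 0 τ + ∫ y in (0 : ℝ)..x, c y * R y τ

theorem continuous_integral_of_continuous {X : Type*} [TopologicalSpace X]
    [FirstCountableTopology X] {g : X → ℝ → ℝ} (hg : Continuous (Function.uncurry g))
    {a b : X → ℝ} (ha : Continuous a) (hb : Continuous b) :
    Continuous fun x ↦ ∫ t in (a x)..(b x), g x t := by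
  have key : ∀ x, ∫ t in (a x)..(b x), g x t
      = (∫ t in (0 : ℝ)..(b x), g x t) - ∫ t in (0 : ℝ)..(a x), g x t := by
    intro x
    have hx : Continuous (g x) := hg.uncurry_left x
    rw [integral_interval_sub_left (hx.intervalIntegrable _ _) (hx.intervalIntegrable _ _)]
  simp_rw [key]
  exact (continuous_parametric_intervalIntegral_of_continuous hg hb).sub
    (continuous_parametric_intervalIntegral_of_continuous hg ha)

theorem abs_integral_mul_le {c : ℝ → ℝ} (hc : Continuous c) (hcs : HasCompactSupport c)
    {g : ℝ → ℝ} {M : ℝ} (hM : ∀ y, |g y| ≤ M) (a b : ℝ) :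
    |∫ y in a..b, c y * g y| ≤ (∫ y, |c y|) * M := by
  have hM0 : 0 ≤ M := (abs_nonneg _).trans (hM 0)
  have hi : Integrable c := hc.integrable_of_hasCompactSupport hcs
  calc |∫ y in a..b, c y * g y|
      ≤ ∫ y in Set.uIoc a b, |c y| * M := by
        rw [← Real.norm_eq_abs]
        refine (norm_integral_le_integral_norm_uIoc).trans ?_
        refine integral_mono_of_nonneg (.of_forall fun _ ↦ norm_nonneg _)
          (hi.abs.mul_const M).integrableOn (.of_forall fun y ↦ ?_)
        simp only [norm_mul, Real.norm_eq_abs]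
        gcongr
        exact hM y
    _ ≤ ∫ y, |c y| * M :=
        setIntegral_le_integral (hi.abs.mul_const M) (.of_forall fun y ↦ by positivity)
    _ = _ := integral_mul_const _ _

theorem integral_exp_weight_le {l : ℝ} (hl : 0 < l) (x h : ℝ) :
    ∫ y in x..(x + h), Real.exp (-(l * (y - x))) ≤ 1 / l := by
  have hd : ∀ y ∈ Set.uIcc x (x + h),
      HasDerivAt (fun y ↦ -(Real.exp (-(l * (y - x))) / l)) (Real.exp (-(l * (y - x)))) y := by
    intro y _
    have h1 : HasDerivAt (fun y ↦ -(l * (y - x))) (-l) y := by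
      simpa using (((hasDerivAt_id y).sub_const x).const_mul l).fun_neg
    have := (h1.exp.div_const l).fun_neg
    refine this.congr_deriv ?_
    rw [mul_neg, neg_div, neg_neg, mul_div_cancel_right₀ _ hl.ne']
  rw [integral_eq_sub_of_hasDerivAt hd (Continuous.intervalIntegrable (by fun_prop) _ _)]
  have : 0 < Real.exp (-(l * (x + h - x))) / l := by positivity
  simp
  simp at this
  linarith

/-- The operator `Q ↦ Q(0, σ) + ∫₀ʸ c(z) Q(z, σ) dz`. -/
noncomputable def rightPart (c : ℝ → ℝ) (Q : ℝ × ℝ → ℝ) (y σ : ℝ) : ℝ :=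
  Q (0, σ) + ∫ z in (0 : ℝ)..y, c z * Q (z, σ)

theorem continuous_rightPart {c : ℝ → ℝ} (hc : Continuous c) {Q : ℝ × ℝ → ℝ} (hQ : Continuous Q) :
    Continuous (Function.uncurry (rightPart c Q)) := by
  unfold rightPart
  refine Continuous.add (by fun_prop) ?_
  exact continuous_integral_of_continuous (X := ℝ × ℝ) (g := fun p z ↦ c z * Q (z, p.2))
    (by fun_prop) continuous_const continuous_fst

theorem abs_rightPart_le {c : ℝ → ℝ} (hc : Continuous c) (hcs : HasCompactSupport c)
    {Q : ℝ × ℝ → ℝ} {M : ℝ} (hM : ∀ p, |Q p| ≤ M) (y σ : ℝ) :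
    |rightPart c Q y σ| ≤ (1 + ∫ y, |c y|) * M := by
  have h := abs_integral_mul_le hc hcs (g := fun z ↦ Q (z, σ)) (fun z ↦ hM _) 0 y
  calc |rightPart c Q y σ| ≤ |Q (0, σ)| + |∫ z in (0 : ℝ)..y, c z * Q (z, σ)| := abs_add_le _ _
    _ ≤ M + (∫ y, |c y|) * M := add_le_add (hM _) h
    _ = _ := by ring

theorem rightPart_sub {c : ℝ → ℝ} (hc : Continuous c) {Q Q' : ℝ × ℝ → ℝ} (hQ : Continuous Q)
    (hQ' : Continuous Q') (y σ : ℝ) :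
    rightPart c (fun p ↦ Q p - Q' p) y σ = rightPart c Q y σ - rightPart c Q' y σ := by
  unfold rightPart
  simp_rw [mul_sub]
  rw [integral_sub (Continuous.intervalIntegrable (by fun_prop) _ _)
    (Continuous.intervalIntegrable (by fun_prop) _ _)]
  ring

/-- The Volterra operator along left-going characteristics, with an exponential weight in `τ`. -/
noncomputable def leftPart (c : ℝ → ℝ) (l : ℝ) (Q : ℝ × ℝ → ℝ) (p : ℝ × ℝ) : ℝ :=
  ∫ y in p.1..(p.1 + max p.2 0 / 2), Real.exp (-(2 * l * (y - p.1))) *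
    (c y * rightPart c Q y (max p.2 0 + 2 * p.1 - 2 * y))

theorem continuous_leftPart_integrand {c : ℝ → ℝ} (hc : Continuous c) (l : ℝ) {Q : ℝ × ℝ → ℝ}
    (hQ : Continuous Q) :
    Continuous (Function.uncurry fun (p : ℝ × ℝ) y ↦ Real.exp (-(2 * l * (y - p.1))) *
    (c y * rightPart c Q y (max p.2 0 + 2 * p.1 - 2 * y))) := by
  have h := continuous_rightPart hc hQ
  have : Continuous fun q : (ℝ × ℝ) × ℝ ↦
      rightPart c Q q.2 (max q.1.2 0 + 2 * q.1.1 - 2 * q.2) :=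
    h.comp (f := fun q : (ℝ × ℝ) × ℝ ↦ (q.2, max q.1.2 0 + 2 * q.1.1 - 2 * q.2)) (by fun_prop)
  simp only [Function.uncurry_def]
  fun_prop

theorem continuous_leftPart {c : ℝ → ℝ} (hc : Continuous c) (l : ℝ) {Q : ℝ × ℝ → ℝ}
    (hQ : Continuous Q) : Continuous (leftPart c l Q) :=
  continuous_integral_of_continuous (continuous_leftPart_integrand hc l hQ)
    (by fun_prop) (by fun_prop)

theorem abs_leftPart_le {c : ℝ → ℝ} (hc : Continuous c) (hcs : HasCompactSupport c) {l : ℝ}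
    (hl : 0 < l) {C : ℝ} (hC : ∀ y, |c y| ≤ C) {Q : ℝ × ℝ → ℝ} {M : ℝ} (hM : ∀ p, |Q p| ≤ M)
    (p : ℝ × ℝ) :
    |leftPart c l Q p| ≤ C * (1 + ∫ y, |c y|) / (2 * l) * M := by
  have hC0 : 0 ≤ C := (abs_nonneg _).trans (hC 0)
  have hh : 0 ≤ max p.2 0 / 2 := by positivity
  calc |leftPart c l Q p| ≤ ∫ y in p.1..(p.1 + max p.2 0 / 2),
        Real.exp (-(2 * l * (y - p.1))) * (C * ((1 + ∫ y, |c y|) * M)) := by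
        rw [← Real.norm_eq_abs, leftPart]
        refine norm_integral_le_of_norm_le (by linarith) (.of_forall fun y _ ↦ ?_)
          (Continuous.intervalIntegrable (by fun_prop) _ _)
        simp only [norm_mul, Real.norm_eq_abs, Real.abs_exp]
        gcongr
        · exact hC y
        · exact abs_rightPart_le hc hcs hM _ _
    _ = (∫ y in p.1..(p.1 + max p.2 0 / 2), Real.exp (-(2 * l * (y - p.1)))) *
        (C * ((1 + ∫ y, |c y|) * M)) := intervalIntegral.integral_mul_const _ _
    _ ≤ 1 / (2 * l) * (C * ((1 + ∫ y, |c y|) * M)) := by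
        have hM0 : 0 ≤ M := (abs_nonneg _).trans (hM 0)
        have : 0 ≤ ∫ y, |c y| := integral_nonneg fun _ ↦ abs_nonneg _
        gcongr
        exact integral_exp_weight_le (by linarith) _ _
    _ = _ := by field_simp

theorem leftPart_sub {c : ℝ → ℝ} (hc : Continuous c) (l : ℝ) {Q Q' : ℝ × ℝ → ℝ}
    (hQ : Continuous Q) (hQ' : Continuous Q') (p : ℝ × ℝ) :
    leftPart c l (fun p ↦ Q p - Q' p) p = leftPart c l Q p - leftPart c l Q' p := by
  unfold leftPart
  rw [← integral_sub
    ((continuous_leftPart_integrand hc l hQ).uncurry_left p |>.intervalIntegrable _ _)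
    ((continuous_leftPart_integrand hc l hQ').uncurry_left p |>.intervalIntegrable _ _)]
  simp_rw [rightPart_sub hc hQ hQ', mul_sub]

open BoundedContinuousFunction in
/-- The equation for `Q = exp (-l τ) R` obtained by eliminating `P` has a continuous solution.
Replacing `τ` by `max τ 0` makes it an equation on the whole plane. -/
theorem exists_weighted_kernel {c : ℝ → ℝ} (hc : Continuous c) (hcs : HasCompactSupport c) :
    ∃ (l : ℝ) (Q : ℝ × ℝ → ℝ), Continuous Q ∧ ∀ p, Q p =
      Real.exp (-(l * max p.2 0)) * (c (p.1 + max p.2 0 / 2) / 2) - leftPart c l Q p := by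
  obtain ⟨C, hC⟩ := hcs.exists_bound_of_continuous hc
  simp only [Real.norm_eq_abs] at hC
  have hC0 : 0 ≤ C := (abs_nonneg _).trans (hC 0)
  set I : ℝ := ∫ y, |c y|
  have hI : 0 ≤ I := integral_nonneg fun _ ↦ abs_nonneg _
  -- With this weight the Volterra operator has norm at most `1 / 2`.
  set l : ℝ := C * (1 + I) + 1
  have hl : 0 < l := by positivity
  have hk : C * (1 + I) / (2 * l) ≤ 1 / 2 := by
    rw [div_le_div_iff₀ (by positivity) (by positivity)]
    simp only [l]; nlinarith
  have hb : ∀ (Q : ℝ × ℝ →ᵇ ℝ) p, |Q p| ≤ ‖Q‖ := fun Q p ↦ Q.norm_coe_le_norm p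
  let T : (ℝ × ℝ →ᵇ ℝ) → (ℝ × ℝ →ᵇ ℝ) := fun Q ↦
    BoundedContinuousFunction.ofNormedAddCommGroup
      (fun p ↦ Real.exp (-(l * max p.2 0)) * (c (p.1 + max p.2 0 / 2) / 2) - leftPart c l Q p)
      (by have := continuous_leftPart hc l Q.continuous; fun_prop)
      (1 * (C / 2) + C * (1 + I) / (2 * l) * ‖Q‖) (by
        intro p
        refine (norm_sub_le _ _).trans (add_le_add ?_ (abs_leftPart_le hc hcs hl hC (hb Q) p))
        rw [norm_mul, norm_div, Real.norm_eq_abs, Real.abs_exp, Real.norm_eq_abs, Real.norm_two]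
        gcongr
        · exact Real.exp_le_one_iff.2 (by have : 0 ≤ max p.2 0 := le_max_right _ _
                                          nlinarith)
        · exact hC _)
  have hT : ContractingWith (1 / 2) T := by
    refine ⟨by norm_num [← NNReal.coe_lt_coe], LipschitzWith.of_dist_le_mul fun Q Q' ↦ ?_⟩
    rw [BoundedContinuousFunction.dist_le (by positivity)]
    intro p
    have h1 : T Q p - T Q' p = - leftPart c l (fun p ↦ Q p - Q' p) p := by
      rw [leftPart_sub hc l Q.continuous Q'.continuous]
      simp only [T, coe_ofNormedAddCommGroup]
      ring
    rw [Real.dist_eq, h1, abs_neg]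
    refine (abs_leftPart_le hc hcs hl hC (M := dist Q Q') (fun p ↦ ?_) p).trans ?_
    · rw [← Real.dist_eq]; exact BoundedContinuousFunction.dist_coe_le_dist p
    · push_cast
      gcongr
  refine ⟨l, ⇑(ContractingWith.fixedPoint T hT), (ContractingWith.fixedPoint T hT).continuous,
    fun p ↦ ?_⟩
  conv_lhs => rw [← hT.fixedPoint_isFixedPt]
  rfl

theorem exists_isKernel {c : ℝ → ℝ} (hc : Continuous c) (hcs : HasCompactSupport c) :
    ∃ P R, IsKernel c P R := by
  obtain ⟨l, Q, hQ, hfix⟩ := exists_weighted_kernel hc hcs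
  let P : ℝ → ℝ → ℝ := fun y σ ↦ Real.exp (l * σ) * rightPart c Q y σ
  have hP : Continuous (Function.uncurry P) := by
    have := continuous_rightPart hc hQ
    simp only [P, Function.uncurry_def] at this ⊢
    fun_prop
  let R : ℝ → ℝ → ℝ := fun x τ ↦
    c (x + τ / 2) / 2 - ∫ y in x..(x + τ / 2), c y * P y (τ + 2 * x - 2 * y)
  have hR : Continuous (Function.uncurry R) := by
    simp only [R, Function.uncurry_def]
    refine Continuous.sub (by fun_prop) ?_
    refine continuous_integral_of_continuous (X := ℝ × ℝ)
      (g := fun p y ↦ c y * P y (p.2 + 2 * p.1 - 2 * y)) ?_ (by fun_prop) (by fun_prop)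
    have : Continuous fun q : (ℝ × ℝ) × ℝ ↦ P q.2 (q.1.2 + 2 * q.1.1 - 2 * q.2) :=
      hP.comp (f := fun q : (ℝ × ℝ) × ℝ ↦ (q.2, q.1.2 + 2 * q.1.1 - 2 * q.2)) (by fun_prop)
    simp only [Function.uncurry_def]
    fun_prop
  have hRQ : ∀ x τ, 0 ≤ τ → R x τ = Real.exp (l * τ) * Q (x, τ) := by
    intro x τ hτ
    rw [hfix]
    simp only [R, leftPart, max_eq_left hτ, mul_sub]
    rw [← mul_assoc, ← Real.exp_add, add_neg_cancel, Real.exp_zero, one_mul,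
      ← intervalIntegral.integral_const_mul]
    congr 1
    refine integral_congr fun y _ ↦ ?_
    simp only [P]
    rw [show l * (τ + 2 * x - 2 * y) = l * τ + -(2 * l * (y - x)) by ring, Real.exp_add]
    ring_nf
  refine ⟨P, R, hP, hR, fun _ _ ↦ rfl, fun x τ hτ ↦ ?_⟩
  simp only [P, rightPart]
  rw [hRQ 0 τ hτ, mul_add, ← intervalIntegral.integral_const_mul]
  congr 1
  refine integral_congr fun y _ ↦ ?_
  rw [hRQ y τ hτ]
  ring

/-! ### The impulse response determines the coefficient -/

namespace IsKernel

variable {c : ℝ → ℝ} {P R : ℝ → ℝ → ℝ}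

/-- The jump at the wave front determines the coefficient. -/
theorem eq_two_mul (hK : IsKernel c P R) (x : ℝ) : c x = 2 * R x 0 := by
  have := hK.eq_R x 0
  simp at this
  linarith

theorem continuous_comp_P (hK : IsKernel c P R) {X : Type*} [TopologicalSpace X] {f g : X → ℝ}
    (hf : Continuous f) (hg : Continuous g) : Continuous fun x ↦ P (f x) (g x) :=
  hK.cont_P.comp (hf.prodMk hg)

theorem continuous_comp_R (hK : IsKernel c P R) {X : Type*} [TopologicalSpace X] {f g : X → ℝ}
    (hf : Continuous f) (hg : Continuous g) : Continuous fun x ↦ R (f x) (g x) :=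
  hK.cont_R.comp (hf.prodMk hg)

theorem continuous_integrand_R (hK : IsKernel c P R) (hc : Continuous c) (r : ℝ) :
    Continuous fun y ↦ c y * P y (r - 2 * y) :=
  hc.mul (hK.continuous_comp_P continuous_id (by fun_prop))

/-- Along a left-going characteristic, `R` is determined by its value at `x = 0`. -/
theorem eq_R_zero (hK : IsKernel c P R) (hc : Continuous c) (x τ : ℝ) :
    R x τ = R 0 (τ + 2 * x) + ∫ y in (0 : ℝ)..x, c y * P y (τ + 2 * x - 2 * y) := by
  have hi := fun a b ↦ (hK.continuous_integrand_R hc (τ + 2 * x)).intervalIntegrable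
    (μ := volume) a b
  rw [hK.eq_R x, hK.eq_R 0, show 0 + (τ + 2 * x) / 2 = x + τ / 2 by ring, mul_zero, add_zero,
    ← integral_add_adjacent_intervals (hi 0 x) (hi x _)]
  ring

end IsKernel

/-- The bounds `E n x = C (3 C x) ^ n / n!` satisfy `E (n + 1) x = ∫₀ˣ 3 C E n`. -/
theorem integral_gronwall_step (C x : ℝ) (n : ℕ) :
    ∫ y in (0 : ℝ)..x, 3 * C * (C * (3 * C * y) ^ n / n.factorial)
      = C * (3 * C * x) ^ (n + 1) / (n + 1).factorial := by
  have : ∀ y : ℝ, 3 * C * (C * (3 * C * y) ^ n / n.factorial)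
      = (3 * C * C * (3 * C) ^ n / n.factorial) * y ^ n := by
    intro y; rw [mul_pow]; ring
  simp_rw [this]
  rw [intervalIntegral.integral_const_mul, integral_pow, Nat.factorial_succ]
  push_cast
  have : (n.factorial : ℝ) ≠ 0 := by positivity
  field_simp
  ring

/-- One step of the Gronwall iteration: the error in the factor `f` contributes `C E`, and the error
in the coefficient, at most twice that of `R` by `IsKernel.eq_two_mul`, contributes `2 C E`. -/
theorem abs_integral_sub_le {c₁ c₂ f₁ f₂ E : ℝ → ℝ} {C x : ℝ} (hx : 0 ≤ x)
    (hE : Continuous E) (h₁ : Continuous fun y ↦ c₁ y * f₁ y) (h₂ : Continuous fun y ↦ c₂ y * f₂ y)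
    (hc : ∀ y ∈ Set.Icc 0 x, |c₁ y| ≤ C) (hf : ∀ y ∈ Set.Icc 0 x, |f₂ y| ≤ C)
    (hd : ∀ y ∈ Set.Icc 0 x, |f₁ y - f₂ y| ≤ E y)
    (hdc : ∀ y ∈ Set.Icc 0 x, |c₁ y - c₂ y| ≤ 2 * E y) :
    |(∫ y in (0 : ℝ)..x, c₁ y * f₁ y) - ∫ y in (0 : ℝ)..x, c₂ y * f₂ y|
      ≤ ∫ y in (0 : ℝ)..x, 3 * C * E y := by
  rw [← integral_sub (h₁.intervalIntegrable _ _) (h₂.intervalIntegrable _ _), ← Real.norm_eq_abs]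
  refine norm_integral_le_of_norm_le hx (.of_forall fun y hy ↦ ?_)
    (Continuous.intervalIntegrable (by fun_prop) _ _)
  have hy' : y ∈ Set.Icc 0 x := ⟨hy.1.le, hy.2⟩
  have hE0 : 0 ≤ E y := (abs_nonneg _).trans (hd y hy')
  have hC0 : 0 ≤ C := (abs_nonneg _).trans (hc y hy')
  calc ‖c₁ y * f₁ y - c₂ y * f₂ y‖ = |c₁ y * (f₁ y - f₂ y) + (c₁ y - c₂ y) * f₂ y| := by
        rw [Real.norm_eq_abs]; congr 1; ring
    _ ≤ |c₁ y| * |f₁ y - f₂ y| + |c₁ y - c₂ y| * |f₂ y| := by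
        rw [← abs_mul, ← abs_mul]; exact abs_add_le _ _
    _ ≤ C * E y + 2 * E y * C := by
        gcongr
        exacts [hc y hy', hd y hy', hdc y hy', hf y hy']
    _ = _ := by ring

/-- The boundary values `R(0, ·)` of the impulse response determine the coefficient: sideways
evolution from `x = 0`, closed by the relation `c(x) = 2 R(x, 0)` on the wave front. -/
theorem IsKernel.coeff_eq {c₁ c₂ : ℝ → ℝ} {P₁ R₁ P₂ R₂ : ℝ → ℝ → ℝ} (h₁ : IsKernel c₁ P₁ R₁)
    (h₂ : IsKernel c₂ P₂ R₂) (hc₁ : Continuous c₁) (hc₂ : Continuous c₂)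
    (h : ∀ τ, 0 ≤ τ → R₁ 0 τ = R₂ 0 τ) {X : ℝ} (hX : 0 ≤ X) : c₁ X = c₂ X := by
  have hbd : ∀ f : ℝ × ℝ → ℝ, Continuous f → ∃ C, ∀ x ∈ Set.Icc 0 X, ∀ τ ∈ Set.Icc 0 (2 * X),
      |f (x, τ)| ≤ C := by
    intro f hf
    obtain ⟨C, hC⟩ := (isCompact_Icc (a := (0 : ℝ)) (b := X)).prod
      (isCompact_Icc (a := (0 : ℝ)) (b := 2 * X)) |>.exists_bound_of_continuousOn hf.continuousOn
    exact ⟨C, fun x hx τ hτ ↦ hC _ ⟨hx, hτ⟩⟩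
  obtain ⟨C₁, hC₁⟩ := hbd (fun p ↦ c₁ p.1) (by fun_prop)
  obtain ⟨C₂, hC₂⟩ := hbd (fun p ↦ P₂ p.1 p.2) h₂.cont_P
  obtain ⟨C₃, hC₃⟩ := hbd (fun p ↦ R₂ p.1 p.2) h₂.cont_R
  obtain ⟨C₄, hC₄⟩ := hbd (fun p ↦ P₁ p.1 p.2 - P₂ p.1 p.2) (h₁.cont_P.sub h₂.cont_P)
  obtain ⟨C₅, hC₅⟩ := hbd (fun p ↦ R₁ p.1 p.2 - R₂ p.1 p.2) (h₁.cont_R.sub h₂.cont_R)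
  set C := max C₁ (max C₂ (max C₃ (max C₄ C₅)))
  -- Both integral equations for a point of this triangle involve only points of the triangle with
  -- smaller `x`, so that the bounds can be iterated.
  have key : ∀ n : ℕ, ∀ x ∈ Set.Icc 0 X, ∀ τ ∈ Set.Icc 0 (2 * (X - x)),
      |P₁ x τ - P₂ x τ| ≤ C * (3 * C * x) ^ n / n.factorial ∧
      |R₁ x τ - R₂ x τ| ≤ C * (3 * C * x) ^ n / n.factorial := by
    intro n
    induction n with
    | zero =>
      intro x hx τ hτ
      have hτ' : τ ∈ Set.Icc 0 (2 * X) := ⟨hτ.1, by linarith [hτ.2, hx.1]⟩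
      simp only [pow_zero, mul_one, Nat.factorial_zero, Nat.cast_one, div_one]
      exact ⟨(hC₄ x hx τ hτ').trans (by simp [C]), (hC₅ x hx τ hτ').trans (by simp [C])⟩
    | succ n ih =>
      intro x hx τ hτ
      rw [← integral_gronwall_step]
      have hsub : ∀ y ∈ Set.Icc 0 x, y ∈ Set.Icc 0 X := fun y hy ↦ ⟨hy.1, hy.2.trans hx.2⟩
      have hdc : ∀ y ∈ Set.Icc 0 x, |c₁ y - c₂ y| ≤ 2 * (C * (3 * C * y) ^ n / n.factorial) := by
        intro y hy
        rw [h₁.eq_two_mul, h₂.eq_two_mul, ← mul_sub, abs_mul, abs_two]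
        have := (ih y (hsub y hy) 0 ⟨le_rfl, by linarith [(hsub y hy).2]⟩).2
        gcongr
      have hEc : Continuous fun y : ℝ ↦ C * (3 * C * y) ^ n / n.factorial := by fun_prop
      have hc' : ∀ y ∈ Set.Icc 0 x, |c₁ y| ≤ C := fun y hy ↦
        (hC₁ y (hsub y hy) 0 ⟨le_rfl, by linarith⟩).trans (by simp [C])
      constructor
      · rw [h₁.eq_P x τ hτ.1, h₂.eq_P x τ hτ.1, h τ hτ.1, add_sub_add_left_eq_sub]
        refine abs_integral_sub_le hx.1 hEc (hc₁.mul (h₁.continuous_comp_R (by fun_prop)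
          (by fun_prop))) (hc₂.mul (h₂.continuous_comp_R (by fun_prop) (by fun_prop)))
          hc' (fun y hy ↦ ?_) (fun y hy ↦ ?_) hdc
        · exact (hC₃ y (hsub y hy) τ ⟨hτ.1, by linarith [hτ.2, hx.1]⟩).trans (by simp [C])
        · exact (ih y (hsub y hy) τ ⟨hτ.1, by linarith [hτ.2, hy.2]⟩).2
      · rw [h₁.eq_R_zero hc₁, h₂.eq_R_zero hc₂, h _ (by linarith [hτ.1, hx.1]),
          add_sub_add_left_eq_sub]
        refine abs_integral_sub_le hx.1 hEc (h₁.continuous_integrand_R hc₁ _)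
          (h₂.continuous_integrand_R hc₂ _) hc' (fun y hy ↦ ?_) (fun y hy ↦ ?_) hdc
        · exact (hC₂ y (hsub y hy) _ ⟨by linarith [hτ.1, hy.2], by linarith [hτ.2, hy.1]⟩).trans
            (by simp [C])
        · exact (ih y (hsub y hy) _ ⟨by linarith [hτ.1, hy.2], by linarith [hτ.2, hy.1]⟩).1
  have hlim : Filter.Tendsto (fun n : ℕ ↦ C * (3 * C * X) ^ n / n.factorial) Filter.atTop
      (𝓝 0) := by
    simpa [mul_div_assoc] using
      (FloorSemiring.tendsto_pow_div_factorial_atTop (3 * C * X)).const_mul C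
  have h0 : |R₁ X 0 - R₂ X 0| ≤ 0 := ge_of_tendsto' hlim fun n ↦
    (key n X ⟨hX, le_rfl⟩ 0 ⟨le_rfl, by simp⟩).2
  rw [h₁.eq_two_mul, h₂.eq_two_mul, sub_eq_zero.1 (abs_nonpos_iff.1 h0)]

/-! ### Differentiation under the integral sign -/

theorem hasDerivAt_integral_of_continuous {g g' : ℝ → ℝ → ℝ} {a b x₀ : ℝ} (hab : a ≤ b)
    (hg : Continuous (Function.uncurry g)) (hg' : Continuous (Function.uncurry g'))
    (hd : ∀ x, ∀ s ∈ Set.Icc a b, HasDerivAt (fun x ↦ g x s) (g' x s) x) :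
    HasDerivAt (fun x ↦ ∫ s in a..b, g x s) (∫ s in a..b, g' x₀ s) x₀ := by
  obtain ⟨M, hM⟩ := (isCompact_Icc (a := x₀ - 1) (b := x₀ + 1)).prod
      (isCompact_Icc (a := a) (b := b)) |>.exists_bound_of_continuousOn hg'.continuousOn
  have hs : Set.uIoc a b ⊆ Set.Icc a b := by
    rw [Set.uIoc_of_le hab]; exact Set.Ioc_subset_Icc_self
  exact (hasDerivAt_integral_of_dominated_loc_of_deriv_le (bound := fun _ ↦ M)
    (Icc_mem_nhds (by linarith) (by linarith) : Set.Icc (x₀ - 1) (x₀ + 1) ∈ 𝓝 x₀)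
    (.of_forall fun x ↦ (hg.uncurry_left x).aestronglyMeasurable)
    ((hg.uncurry_left x₀).intervalIntegrable _ _) (hg'.uncurry_left x₀).aestronglyMeasurable
    (.of_forall fun s hs' x hx ↦ hM (x, s) ⟨hx, hs hs'⟩) intervalIntegrable_const
    (.of_forall fun s hs' x _ ↦ hd x s (hs hs'))).2

theorem hasFDerivAt_of_partials {f f₁ f₂ : ℝ → ℝ → ℝ}
    (h₁ : ∀ x y, HasDerivAt (fun x ↦ f x y) (f₁ x y) x) (h₂ : ∀ x y, HasDerivAt (f x) (f₂ x y) y)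
    (c₁ : Continuous (Function.uncurry f₁)) (c₂ : Continuous (Function.uncurry f₂)) (p : ℝ × ℝ) :
    HasFDerivAt (Function.uncurry f) (f₁ p.1 p.2 • ContinuousLinearMap.fst ℝ ℝ ℝ
      + f₂ p.1 p.2 • ContinuousLinearMap.snd ℝ ℝ ℝ) p := by
  have := (hasStrictFDerivAt_uncurry_coprod (𝕜 := ℝ) (u := p) (f := f)
    (f₁ := fun x y ↦ ContinuousLinearMap.toSpanSingleton ℝ (f₁ x y))
    (f₂ := fun x y ↦ ContinuousLinearMap.toSpanSingleton ℝ (f₂ x y))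
    (.of_forall fun v ↦ (h₁ v.1 v.2).hasFDerivAt) (.of_forall fun v ↦ (h₂ v.1 v.2).hasFDerivAt)
    ((ContinuousLinearMap.toSpanSingletonCLE (𝕜 := ℝ) (E := ℝ)).continuous.comp c₁).continuousAt
    ((ContinuousLinearMap.toSpanSingletonCLE (𝕜 := ℝ) (E := ℝ)).continuous.comp
      c₂).continuousAt).hasFDerivAt
  refine this.congr_fderiv ?_
  ext <;> simp [Function.HasUncurry.uncurry]

theorem contDiff_succ_of_partials {f f₁ f₂ : ℝ → ℝ → ℝ} {n : ℕ}
    (h₁ : ∀ x y, HasDerivAt (fun x ↦ f x y) (f₁ x y) x) (h₂ : ∀ x y, HasDerivAt (f x) (f₂ x y) y)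
    (c₁ : ContDiff ℝ n (Function.uncurry f₁)) (c₂ : ContDiff ℝ n (Function.uncurry f₂)) :
    ContDiff ℝ (n + 1 : ℕ) (Function.uncurry f) := by
  push_cast
  rw [contDiff_succ_iff_hasFDerivAt]
  refine ⟨_, ?_, hasFDerivAt_of_partials h₁ h₂ c₁.continuous c₂.continuous⟩
  exact (c₁.smul contDiff_const).add (c₂.smul contDiff_const)

/-- Leibniz' rule with a moving lower limit. -/
theorem hasDerivAt_integral_moving {g g' : ℝ → ℝ → ℝ} {a : ℝ → ℝ} {a' b x₀ : ℝ}
    (hg : Continuous (Function.uncurry g)) (hg' : Continuous (Function.uncurry g'))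
    (hd : ∀ x s, HasDerivAt (fun x ↦ g x s) (g' x s) x) (ha : HasDerivAt a a' x₀) :
    HasDerivAt (fun x ↦ ∫ s in (a x)..b, g x s)
      (-(a' * g x₀ (a x₀)) + ∫ s in (a x₀)..b, g' x₀ s) x₀ := by
  have h₁ : ∀ x y, HasDerivAt (fun x ↦ ∫ s in x..b, g y s) (-g y x) x := fun x y ↦
    integral_hasDerivAt_left ((hg.uncurry_left y).intervalIntegrable _ _)
      (hg.uncurry_left y).aestronglyMeasurable.stronglyMeasurableAtFilter
      (hg.uncurry_left y).continuousAt
  have h₂ : ∀ x y, HasDerivAt (fun y ↦ ∫ s in x..b, g y s) (∫ s in x..b, g' y s) y := by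
    intro x y
    rcases le_total x b with h | h
    · exact hasDerivAt_integral_of_continuous h hg hg' fun _ _ _ ↦ hd _ _
    · simp_rw [integral_symm b x]
      exact (hasDerivAt_integral_of_continuous h hg hg' fun _ _ _ ↦ hd _ _).fun_neg
  have c₁ : Continuous (Function.uncurry fun x y ↦ -g y x) :=
    (hg.comp (continuous_snd.prodMk continuous_fst)).neg
  have c₂ : Continuous (Function.uncurry fun x y ↦ ∫ s in x..b, g' y s) :=
    continuous_integral_of_continuous (X := ℝ × ℝ) (g := fun p s ↦ g' p.2 s)
      (hg'.comp (f := fun q : (ℝ × ℝ) × ℝ ↦ (q.1.2, q.2)) (by fun_prop))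
      continuous_fst continuous_const
  have := (hasFDerivAt_of_partials h₁ h₂ c₁ c₂ (a x₀, x₀)).comp_hasDerivAt (f := fun x ↦ (a x, x))
    x₀ (ha.prodMk (hasDerivAt_id x₀))
  refine this.congr_deriv ?_
  simp
  ring

/-! ### Causal convolution -/

/-- The superposition of a time-translated causal kernel: `∫₀^∞ K(x, s) F(τ - s) ds`. -/
noncomputable def causalConv (K : ℝ → ℝ → ℝ) (F : ℝ → ℝ) (x τ : ℝ) : ℝ :=
  ∫ s in Set.Ioi (0 : ℝ), K x s * F (τ - s)

/-- Smooth functions on the line vanishing to the left of `t₀`. -/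
structure IsSource (t₀ : ℝ) (F : ℝ → ℝ) : Prop where
  smooth : ContDiff ℝ ∞ F
  zero : ∀ t < t₀, F t = 0

theorem IsSource.hasDerivAt {t₀ : ℝ} {F : ℝ → ℝ} (hF : IsSource t₀ F) (t : ℝ) :
    HasDerivAt F (deriv F t) t :=
  (hF.smooth.differentiable (by simp)).differentiableAt.hasDerivAt

theorem IsSource.deriv {t₀ : ℝ} {F : ℝ → ℝ} (hF : IsSource t₀ F) : IsSource t₀ (deriv F) where
  smooth := (contDiff_infty_iff_deriv.1 hF.smooth).2
  zero t ht := by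
    have : F =ᶠ[𝓝 t] fun _ ↦ 0 := by
      filter_upwards [Iio_mem_nhds ht] with s hs using hF.zero s hs
    rw [this.deriv_eq, deriv_const]

/-- A source vanishing to the left of `t₀` truncates the convolution to a bounded interval. -/
theorem causalConv_eq {t₀ : ℝ} {F : ℝ → ℝ} (hF : IsSource t₀ F) (K : ℝ → ℝ → ℝ) (x : ℝ) {τ B : ℝ}
    (hB : 0 ≤ B) (hτ : τ < t₀ + B) :
    causalConv K F x τ = ∫ s in (0 : ℝ)..B, K x s * F (τ - s) := by
  rw [causalConv, integral_of_le hB]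
  refine (setIntegral_eq_of_subset_of_forall_sdiff_eq_zero measurableSet_Ioi
    Set.Ioc_subset_Ioi_self fun s hs ↦ ?_)
  have hs' : B < s := by
    by_contra h
    exact hs.2 ⟨hs.1, not_lt.1 h⟩
  rw [hF.zero _ (by linarith), mul_zero]

theorem causalConv_eq_zero {t₀ : ℝ} {F : ℝ → ℝ} (hF : IsSource t₀ F) (K : ℝ → ℝ → ℝ) (x : ℝ) {τ : ℝ}
    (hτ : τ < t₀) : causalConv K F x τ = 0 := by
  rw [causalConv_eq hF K x le_rfl (by linarith), integral_same]

theorem continuous_causalConv_integrand {t₀ : ℝ} {F : ℝ → ℝ} (hF : IsSource t₀ F) {K : ℝ → ℝ → ℝ}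
    (hK : Continuous (Function.uncurry K)) :
    Continuous (Function.uncurry fun (p : ℝ × ℝ) s ↦ K p.1 s * F (p.2 - s)) :=
  (hK.comp (f := fun q : (ℝ × ℝ) × ℝ ↦ (q.1.1, q.2)) (by fun_prop)).mul
    (hF.smooth.continuous.comp (f := fun q : (ℝ × ℝ) × ℝ ↦ q.1.2 - q.2) (by fun_prop))

theorem continuous_causalConv {t₀ : ℝ} {F : ℝ → ℝ} (hF : IsSource t₀ F) {K : ℝ → ℝ → ℝ}
    (hK : Continuous (Function.uncurry K)) : Continuous (Function.uncurry (causalConv K F)) := by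
  rw [continuous_iff_continuousAt]
  intro p
  set B := max 0 (p.2 - t₀ + 1)
  have hB : p.2 < t₀ + B := by have := le_max_right 0 (p.2 - t₀ + 1); simp only [B]; linarith
  have h1 : Continuous fun p : ℝ × ℝ ↦ ∫ s in (0 : ℝ)..B, K p.1 s * F (p.2 - s) :=
    continuous_integral_of_continuous (continuous_causalConv_integrand hF hK) continuous_const
      continuous_const
  refine h1.continuousAt.congr ?_
  filter_upwards [(isOpen_Iio.preimage continuous_snd).mem_nhds (show p ∈ Prod.snd ⁻¹' Set.Iio _
    from hB)] with q hq
  exact (causalConv_eq hF K q.1 (le_max_left _ _) hq).symm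

theorem hasDerivAt_causalConv_time {t₀ : ℝ} {F : ℝ → ℝ} (hF : IsSource t₀ F) {K : ℝ → ℝ → ℝ}
    (hK : Continuous (Function.uncurry K)) (x τ : ℝ) :
    HasDerivAt (causalConv K F x) (causalConv K (deriv F) x τ) τ := by
  set B := max 0 (τ - t₀ + 1)
  have hB : τ < t₀ + B := by have := le_max_right 0 (τ - t₀ + 1); simp only [B]; linarith
  have hc : ∀ {G}, IsSource t₀ G → Continuous (Function.uncurry fun τ s ↦ K x s * G (τ - s)) :=
    fun hG ↦ (continuous_causalConv_integrand hG hK).comp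
      (f := fun q : ℝ × ℝ ↦ ((x, q.1), q.2)) (by fun_prop)
  rw [causalConv_eq hF.deriv K x (le_max_left _ _) hB]
  refine (hasDerivAt_integral_of_continuous (le_max_left _ _) (hc hF) (hc hF.deriv)
    fun τ s _ ↦ ((hF.hasDerivAt (τ - s)).comp_sub_const τ s).const_mul _).congr_of_eventuallyEq ?_
  filter_upwards [Iio_mem_nhds hB] with q hq
  exact causalConv_eq hF K x (le_max_left _ _) hq

theorem hasDerivAt_causalConv_space {t₀ : ℝ} {F : ℝ → ℝ} (hF : IsSource t₀ F) {K K' : ℝ → ℝ → ℝ}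
    (hK : Continuous (Function.uncurry K)) (hK' : Continuous (Function.uncurry K'))
    (hd : ∀ x s, 0 ≤ s → HasDerivAt (fun x ↦ K x s) (K' x s) x) (x τ : ℝ) :
    HasDerivAt (fun x ↦ causalConv K F x τ) (causalConv K' F x τ) x := by
  set B := max 0 (τ - t₀ + 1)
  have hB : τ < t₀ + B := by have := le_max_right 0 (τ - t₀ + 1); simp only [B]; linarith
  have hc : ∀ {K}, Continuous (Function.uncurry K) →
      Continuous (Function.uncurry fun x s ↦ K x s * F (τ - s)) :=
    fun hK ↦ (continuous_causalConv_integrand hF hK).comp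
      (f := fun q : ℝ × ℝ ↦ ((q.1, τ), q.2)) (by fun_prop)
  simp_rw [fun K x ↦ causalConv_eq hF K x (le_max_left _ _) hB]
  exact hasDerivAt_integral_of_continuous (le_max_left _ _) (hc hK) (hc hK')
    fun x s hs ↦ (hd x s hs.1).mul_const _

/-! ### Smooth solutions -/

/-- The right-going component, in retarded time, of the solution with source `F`: the tail `P` and
the impulse `-δ` on the wave front. The left-going component is `causalConv R F`. -/
noncomputable def rightWave (P : ℝ → ℝ → ℝ) (F : ℝ → ℝ) (x τ : ℝ) : ℝ := causalConv P F x τ - F τ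

section

variable {c : ℝ → ℝ} {P R : ℝ → ℝ → ℝ} {t₀ : ℝ} {F : ℝ → ℝ}

theorem IsKernel.continuous_rightWave (hK : IsKernel c P R) (hF : IsSource t₀ F) :
    Continuous (Function.uncurry (rightWave P F)) :=
  (continuous_causalConv hF hK.cont_P).sub (hF.smooth.continuous.comp continuous_snd)

theorem IsKernel.hasDerivAt_rightWave_time (hK : IsKernel c P R) (hF : IsSource t₀ F) (x τ : ℝ) :
    HasDerivAt (rightWave P F x) (rightWave P (deriv F) x τ) τ :=
  (hasDerivAt_causalConv_time hF hK.cont_P x τ).sub (hF.hasDerivAt τ)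

/-- The equation `(∂ₜ + ∂ₓ) p = c r` in retarded time. -/
theorem IsKernel.hasDerivAt_rightWave_space (hK : IsKernel c P R) (hc : Continuous c)
    (hF : IsSource t₀ F) (x τ : ℝ) :
    HasDerivAt (fun x ↦ rightWave P F x τ) (c x * causalConv R F x τ) x := by
  have hcR : Continuous (Function.uncurry fun x s ↦ c x * R x s) :=
    (hc.comp continuous_fst).mul hK.cont_R
  have h := (hasDerivAt_causalConv_space hF hK.cont_P (K' := fun x s ↦ c x * R x s) hcR
    (fun x s hs ↦ ?_) x τ).sub_const (F τ)
  · refine h.congr_deriv ?_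
    simp only [causalConv, mul_assoc]
    exact MeasureTheory.integral_const_mul _ _
  · have hcs : Continuous fun y ↦ c y * R y s := hcR.uncurry_right s
    have : (fun x ↦ P x s) = fun x ↦ R 0 s + ∫ y in (0 : ℝ)..x, c y * R y s :=
      funext fun x ↦ hK.eq_P x s hs
    rw [this]
    exact (integral_hasDerivAt_right (hcs.intervalIntegrable _ _)
      hcs.aestronglyMeasurable.stronglyMeasurableAtFilter hcs.continuousAt).const_add _

/-- The derivative of `R` along a left-going characteristic `τ + 2 x = w`. -/
theorem IsKernel.hasDerivAt_R_characteristic (hK : IsKernel c P R) (hc : Continuous c) (w x : ℝ) :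
    HasDerivAt (fun x ↦ R x (w - 2 * x)) (c x * P x (w - 2 * x)) x := by
  have hi : Continuous fun y ↦ c y * P y (w - 2 * y) := hK.continuous_integrand_R hc w
  have : (fun x ↦ R x (w - 2 * x))
      = fun x ↦ c (w / 2) / 2 - ∫ y in x..(w / 2), c y * P y (w - 2 * y) := by
    funext x
    rw [hK.eq_R, show x + (w - 2 * x) / 2 = w / 2 by ring, show w - 2 * x + 2 * x = w by ring]
  rw [this]
  simpa using (integral_hasDerivAt_left (b := w / 2) (hi.intervalIntegrable x _)
      hi.aestronglyMeasurable.stronglyMeasurableAtFilter hi.continuousAt).const_sub (c (w / 2) / 2)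

/-- The left-going component along a left-going characteristic. The convolution is over points
behind the wave front, which moves as `x` varies; the resulting boundary term
`-2 R(x, 0) F = -c F` is the contribution of the impulse to `c · rightWave P F`. -/
theorem IsKernel.hasDerivAt_leftWave_characteristic (hK : IsKernel c P R) (hc : Continuous c)
    (hF : IsSource t₀ F) (r x : ℝ) :
    HasDerivAt (fun x ↦ causalConv R F x (r - 2 * x)) (c x * rightWave P F x (r - 2 * x)) x := by
  set M := max (2 * x) (r - t₀) + 1
  have hM₁ : 2 * x < M := by have := le_max_left (2 * x) (r - t₀); simp only [M]; linarith
  have hM₂ : r - t₀ < M := by have := le_max_right (2 * x) (r - t₀); simp only [M]; linarith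
  -- In the variable `w = s + 2 x` the source no longer depends on `x`.
  have hrep : ∀ K : ℝ → ℝ → ℝ, ∀ x, 2 * x < M → causalConv K F x (r - 2 * x)
      = ∫ w in (2 * x)..M, K x (w - 2 * x) * F (r - w) := by
    intro K x hx
    rw [causalConv_eq hF K x (B := M - 2 * x) (by linarith) (by linarith)]
    have := intervalIntegral.integral_comp_sub_right (a := 2 * x) (b := M)
      (fun s ↦ K x s * F (r - 2 * x - s)) (2 * x)
    rw [sub_self] at this
    rw [← this]
    refine integral_congr fun w _ ↦ ?_
    congr 2
    ring
  have hg : ∀ {K : ℝ → ℝ → ℝ}, Continuous (Function.uncurry K) →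
      Continuous (Function.uncurry fun x w ↦ K x (w - 2 * x) * F (r - w)) := fun hK ↦
    (hK.comp (f := fun q : ℝ × ℝ ↦ (q.1, q.2 - 2 * q.1)) (by fun_prop)).mul
      (hF.smooth.continuous.comp (f := fun q : ℝ × ℝ ↦ r - q.2) (by fun_prop))
  have hd := hasDerivAt_integral_moving (b := M) (a := fun x ↦ 2 * x) (a' := 2) (x₀ := x)
    (g := fun x w ↦ R x (w - 2 * x) * F (r - w))
    (g' := fun x w ↦ c x * P x (w - 2 * x) * F (r - w)) (hg hK.cont_R)
    (hg (K := fun x s ↦ c x * P x s) ((hc.comp continuous_fst).mul hK.cont_P))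
    (fun x w ↦ (hK.hasDerivAt_R_characteristic hc w x).mul_const _)
    (by simpa using (hasDerivAt_id x).const_mul 2)
  refine (hd.congr_of_eventuallyEq ?_).congr_deriv ?_
  · filter_upwards [Iio_mem_nhds (show x < M / 2 by linarith)] with y hy
    exact hrep R y (by linarith [Set.mem_Iio.1 hy])
  · rw [rightWave, hrep P x hM₁, hK.eq_two_mul x]
    simp only [sub_self, mul_assoc, intervalIntegral.integral_const_mul]
    ring

/-- The equation `(∂ₜ - ∂ₓ) r = -c p` in retarded time. -/
theorem IsKernel.hasDerivAt_leftWave_space (hK : IsKernel c P R) (hc : Continuous c)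
    (hF : IsSource t₀ F) (x τ : ℝ) :
    HasDerivAt (fun x ↦ causalConv R F x τ)
      (2 * causalConv R (deriv F) x τ + c x * rightWave P F x τ) x := by
  have hcomp : ∀ {f : ℝ → ℝ → ℝ}, Continuous (Function.uncurry f) →
      Continuous (Function.uncurry fun x r ↦ f x (r - 2 * x)) := fun hf ↦
    hf.comp (f := fun q : ℝ × ℝ ↦ (q.1, q.2 - 2 * q.1)) (by fun_prop)
  have h := hasFDerivAt_of_partials (f := fun x r ↦ causalConv R F x (r - 2 * x))
    (f₁ := fun x r ↦ c x * rightWave P F x (r - 2 * x))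
    (f₂ := fun x r ↦ causalConv R (deriv F) x (r - 2 * x))
    (fun x r ↦ hK.hasDerivAt_leftWave_characteristic hc hF r x)
    (fun x r ↦ (hasDerivAt_causalConv_time hF hK.cont_R x (r - 2 * x)).comp_sub_const r (2 * x))
    ((hc.comp continuous_fst).mul (hcomp (hK.continuous_rightWave hF)))
    (hcomp (continuous_causalConv hF.deriv hK.cont_R)) (x, τ + 2 * x)
  have h' := h.comp_hasDerivAt (f := fun x ↦ (x, τ + 2 * x)) x ((hasDerivAt_id x).prodMk
    (((hasDerivAt_id x).const_mul 2).const_add τ))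
  simp only [Function.comp_def, Function.uncurry_apply_pair, add_sub_cancel_right] at h'
  refine h'.congr_deriv ?_
  simp
  ring

/-- Smoothness of both components: differentiation in time amounts to differentiating the source,
and the first-order system then trades space derivatives for time derivatives. -/
theorem IsKernel.contDiff_waves (hK : IsKernel c P R) (hc : ContDiff ℝ ∞ c) (n : ℕ) :
    ∀ F, IsSource t₀ F → ContDiff ℝ n (Function.uncurry (rightWave P F)) ∧
      ContDiff ℝ n (Function.uncurry (causalConv R F)) := by
  induction n with
  | zero =>
    intro F hF
    simp only [Nat.cast_zero, contDiff_zero]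
    exact ⟨hK.continuous_rightWave hF, continuous_causalConv hF hK.cont_R⟩
  | succ n ih =>
    intro F hF
    have hcn : ContDiff ℝ n fun p : ℝ × ℝ ↦ c p.1 :=
      (hc.of_le (by exact_mod_cast le_top)).comp contDiff_fst
    refine ⟨contDiff_succ_of_partials (fun x τ ↦ hK.hasDerivAt_rightWave_space hc.continuous hF x τ)
      (fun x τ ↦ hK.hasDerivAt_rightWave_time hF x τ) (hcn.mul (ih F hF).2) (ih _ hF.deriv).1,
      contDiff_succ_of_partials (fun x τ ↦ hK.hasDerivAt_leftWave_space hc.continuous hF x τ)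
      (fun x τ ↦ hasDerivAt_causalConv_time hF hK.cont_R x τ) ?_ (ih _ hF.deriv).2⟩
    exact (contDiff_const.mul (ih _ hF.deriv).2).add (hcn.mul (ih F hF).1)

end

/-! ### Partial derivatives -/

/-- The partial derivative in `x`. -/
noncomputable def pdx (g : ℝ × ℝ → ℝ) (z : ℝ × ℝ) : ℝ := fderiv ℝ g z (1, 0)

/-- The partial derivative in `t`. -/
noncomputable def pdt (g : ℝ × ℝ → ℝ) (z : ℝ × ℝ) : ℝ := fderiv ℝ g z (0, 1)

theorem pdx_eq {g : ℝ × ℝ → ℝ} (hg : ContDiff ℝ ∞ g) {x t d : ℝ}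
    (h : HasDerivAt (fun x ↦ g (x, t)) d x) : pdx g (x, t) = d := by
  have h1 := (hg.differentiable (by simp)).differentiableAt.hasFDerivAt (x := (x, t))
  exact (h1.comp_hasDerivAt (f := fun x ↦ (x, t)) x ((hasDerivAt_id x).prodMk
    (hasDerivAt_const x t))).unique h

theorem pdt_eq {g : ℝ × ℝ → ℝ} (hg : ContDiff ℝ ∞ g) {x t d : ℝ}
    (h : HasDerivAt (fun t ↦ g (x, t)) d t) : pdt g (x, t) = d := by
  have h1 := (hg.differentiable (by simp)).differentiableAt.hasFDerivAt (x := (x, t))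
  exact (h1.comp_hasDerivAt (f := fun t ↦ (x, t)) t ((hasDerivAt_const t x).prodMk
    (hasDerivAt_id t))).unique h

theorem contDiff_pdx {g : ℝ × ℝ → ℝ} (hg : ContDiff ℝ ∞ g) : ContDiff ℝ ∞ (pdx g) :=
  (hg.fderiv_right (m := ∞) (by simp)).clm_apply contDiff_const

theorem contDiff_pdt {g : ℝ × ℝ → ℝ} (hg : ContDiff ℝ ∞ g) : ContDiff ℝ ∞ (pdt g) :=
  (hg.fderiv_right (m := ∞) (by simp)).clm_apply contDiff_const

/-- Smooth solutions of the wave equation on the plane, in divergence form. -/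
structure IsWave (A : ℝ → ℝ) (u : ℝ × ℝ → ℝ) : Prop where
  smooth : ContDiff ℝ ∞ u
  eq : ∀ z, A z.1 * pdt (pdt u) z = pdx (fun z ↦ A z.1 * pdx u z) z

/-! ### The coefficient -/

/-- The logarithmic derivative of `√A`. -/
noncomputable def logCoeff (A : ℝ → ℝ) (x : ℝ) : ℝ := deriv A x / (2 * A x)

namespace Admissible

variable {A : ℝ → ℝ}

theorem hasDerivAt (hA : Admissible A) (x : ℝ) : HasDerivAt A (deriv A x) x :=
  (hA.smooth.differentiable (by simp)).differentiableAt.hasDerivAt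

theorem contDiff_logCoeff (hA : Admissible A) : ContDiff ℝ ∞ (logCoeff A) :=
  (contDiff_infty_iff_deriv.1 hA.smooth).2.div (contDiff_const.mul hA.smooth)
    fun x ↦ by have := hA.pos x; positivity

theorem hasCompactSupport_logCoeff (hA : Admissible A) : HasCompactSupport (logCoeff A) := by
  obtain ⟨xm, xp, Ainf, -, -, -, h₁, h₂⟩ := hA.ends
  refine HasCompactSupport.intro (isCompact_Icc (a := xm) (b := xp)) fun x hx ↦ ?_
  have h0 : deriv A x = 0 := by
    rcases not_and_or.1 hx with h | h
    · have : A =ᶠ[𝓝 x] fun _ ↦ 1 := by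
        filter_upwards [Iio_mem_nhds (not_le.1 h)] with y hy using h₁ y hy
      rw [this.deriv_eq, deriv_const]
    · have : A =ᶠ[𝓝 x] fun _ ↦ Ainf := by
        filter_upwards [Ioi_mem_nhds (not_le.1 h)] with y hy using h₂ y hy
      rw [this.deriv_eq, deriv_const]
  rw [logCoeff, h0, zero_div]

theorem contDiff_sqrt (hA : Admissible A) : ContDiff ℝ ∞ fun x ↦ √(A x) :=
  hA.smooth.sqrt fun x ↦ (hA.pos x).ne'

theorem hasDerivAt_sqrt (hA : Admissible A) (x : ℝ) :
    HasDerivAt (fun x ↦ √(A x)) (logCoeff A x * √(A x)) x := by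
  refine ((hA.hasDerivAt x).sqrt (hA.pos x).ne').congr_deriv ?_
  have h := Real.mul_self_sqrt (hA.pos x).le
  have h0 : 0 < √(A x) := Real.sqrt_pos.2 (hA.pos x)
  have hA0 := hA.pos x
  rw [logCoeff, div_mul_eq_mul_div, div_eq_div_iff (by positivity) (by positivity)]
  linear_combination (-2 * deriv A x) * h

theorem exists_pos_eq_one (hA : Admissible A) : ∃ δ, 0 < δ ∧ ∀ x < δ, A x = 1 := by
  obtain ⟨xm, -, -, h, -, -, h₁, -⟩ := hA.ends
  exact ⟨xm, h, h₁⟩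

theorem apply_zero (hA : Admissible A) : A 0 = 1 := by
  obtain ⟨δ, h, h₁⟩ := hA.exists_pos_eq_one
  exact h₁ 0 h

end Admissible

/-! ### The mixed problem -/

/-- The chain rule for the passage from the retarded time `τ` to `t = τ + x`. -/
theorem hasDerivAt_sub_retarded {f f₁ f₂ : ℝ → ℝ → ℝ}
    (h₁ : ∀ x y, HasDerivAt (fun x ↦ f x y) (f₁ x y) x) (h₂ : ∀ x y, HasDerivAt (f x) (f₂ x y) y)
    (c₁ : Continuous (Function.uncurry f₁)) (c₂ : Continuous (Function.uncurry f₂)) (x t : ℝ) :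
    HasDerivAt (fun x ↦ f x (t - x)) (f₁ x (t - x) - f₂ x (t - x)) x := by
  have h := (hasFDerivAt_of_partials h₁ h₂ c₁ c₂ (x, t - x)).comp_hasDerivAt
    (f := fun x ↦ (x, t - x)) x ((hasDerivAt_id x).prodMk ((hasDerivAt_id x).const_sub t))
  refine h.congr_deriv ?_
  simp
  ring

/-- Existence of the solution of the mixed problem with Neumann data `F'`. It vanishes for
`t - x < t₀`, by finite propagation speed, and `R(0, ·)` is the kernel of its Dirichlet data. -/
theorem Admissible.exists_isWave {A : ℝ → ℝ} (hA : Admissible A) {P R : ℝ → ℝ → ℝ}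
    (hK : IsKernel (logCoeff A) P R) {t₀ : ℝ} {F : ℝ → ℝ} (hF : IsSource t₀ F) :
    ∃ u, IsWave A u ∧ (∀ t, pdx u (0, t) = deriv F t) ∧ (∀ x t, t - x < t₀ → u (x, t) = 0) ∧
      ∀ t, u (0, t) = 2 * causalConv R F 0 t - F t := by
  set c := logCoeff A with hcdef
  have hc : Continuous c := hA.contDiff_logCoeff.continuous
  set p : (ℝ → ℝ) → ℝ → ℝ → ℝ := fun F x t ↦ rightWave P F x (t - x) with hp
  set r : (ℝ → ℝ) → ℝ → ℝ → ℝ := fun F x t ↦ causalConv R F x (t - x) with hr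
  have hA0 : ∀ x, √(A x) ≠ 0 := fun x ↦ (Real.sqrt_pos.2 (hA.pos x)).ne'
  have hAs : ∀ x, √(A x) * √(A x) = A x := fun x ↦ Real.mul_self_sqrt (hA.pos x).le
  have hpt : ∀ {F}, IsSource t₀ F → ∀ x t, HasDerivAt (p F x) (p (deriv F) x t) t := fun hF x t ↦
    (hK.hasDerivAt_rightWave_time hF x (t - x)).comp_sub_const t x
  have hrt : ∀ {F}, IsSource t₀ F → ∀ x t, HasDerivAt (r F x) (r (deriv F) x t) t := fun hF x t ↦
    (hasDerivAt_causalConv_time hF hK.cont_R x (t - x)).comp_sub_const t x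
  have hpx : ∀ {F}, IsSource t₀ F → ∀ x t,
      HasDerivAt (fun x ↦ p F x t) (c x * r F x t - p (deriv F) x t) x := fun hF x t ↦
    hasDerivAt_sub_retarded (fun x τ ↦ hK.hasDerivAt_rightWave_space hc hF x τ)
      (fun x τ ↦ hK.hasDerivAt_rightWave_time hF x τ)
      ((hc.comp continuous_fst).mul (continuous_causalConv hF hK.cont_R))
      (hK.continuous_rightWave hF.deriv) x t
  have hrx : ∀ {F}, IsSource t₀ F → ∀ x t,
      HasDerivAt (fun x ↦ r F x t) (r (deriv F) x t + c x * p F x t) x := fun hF x t ↦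
    (hasDerivAt_sub_retarded (fun x τ ↦ hK.hasDerivAt_leftWave_space hc hF x τ)
      (fun x τ ↦ hasDerivAt_causalConv_time hF hK.cont_R x τ)
      ((continuous_const.mul (continuous_causalConv hF.deriv hK.cont_R)).add
        ((hc.comp continuous_fst).mul (hK.continuous_rightWave hF)))
      (continuous_causalConv hF.deriv hK.cont_R) x t).congr_deriv (by simp only [hp, hr]; ring)
  have hsm : ∀ {F}, IsSource t₀ F → ContDiff ℝ ∞ (fun z : ℝ × ℝ ↦ p F z.1 z.2) ∧
      ContDiff ℝ ∞ (fun z : ℝ × ℝ ↦ r F z.1 z.2) := by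
    intro F hF
    have hch : ContDiff ℝ ∞ fun z : ℝ × ℝ ↦ (z.1, z.2 - z.1) := by fun_prop
    exact ⟨(contDiff_infty.2 fun n ↦ (hK.contDiff_waves hA.contDiff_logCoeff n F hF).1).comp hch,
      (contDiff_infty.2 fun n ↦ (hK.contDiff_waves hA.contDiff_logCoeff n F hF).2).comp hch⟩
  have hsq : ContDiff ℝ ∞ fun z : ℝ × ℝ ↦ √(A z.1) := hA.contDiff_sqrt.comp contDiff_fst
  have hsi : ContDiff ℝ ∞ fun z : ℝ × ℝ ↦ (√(A z.1))⁻¹ := hsq.inv fun z ↦ hA0 z.1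
  have hinv : ∀ x, HasDerivAt (fun x ↦ (√(A x))⁻¹) (-(c x * (√(A x))⁻¹)) x := by
    intro x
    refine ((hA.hasDerivAt_sqrt x).inv (hA0 x)).congr_deriv ?_
    have := hA0 x
    field_simp
    rw [hcdef]
  -- The solution with source `F`; its time derivative is the solution with source `F'`.
  set u : (ℝ → ℝ) → ℝ × ℝ → ℝ := fun F z ↦ (√(A z.1))⁻¹ * (p F z.1 z.2 + r F z.1 z.2) with hu
  have husm : ∀ {F}, IsSource t₀ F → ContDiff ℝ ∞ (u F) := fun hF ↦
    hsi.mul ((hsm hF).1.add (hsm hF).2)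
  have hut : ∀ {F}, IsSource t₀ F → pdt (u F) = u (deriv F) := by
    intro F hF
    funext ⟨x, t⟩
    exact pdt_eq (husm hF) (((hpt hF x t).fun_add (hrt hF x t)).const_mul (√(A x))⁻¹)
  have hux : ∀ {F}, IsSource t₀ F → ∀ z, A z.1 * pdx (u F) z
      = √(A z.1) * (r (deriv F) z.1 z.2 - p (deriv F) z.1 z.2) := by
    intro F hF ⟨x, t⟩
    rw [pdx_eq (husm hF) ((hinv x).fun_mul ((hpx hF x t).fun_add (hrx hF x t)))]
    have := hA0 x
    have h := hAs x
    simp only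
    generalize √(A x) = a at this h ⊢
    rw [← h]
    field_simp
    ring
  refine ⟨u F, ⟨husm hF, ?_⟩, ?_, ?_, ?_⟩
  · rintro ⟨x, t⟩
    rw [hut hF, hut hF.deriv, show (fun z ↦ A z.1 * pdx (u F) z) = _ from funext (hux hF),
      pdx_eq (hsq.mul ((hsm hF.deriv).2.sub (hsm hF.deriv).1))
        ((hA.hasDerivAt_sqrt x).fun_mul ((hrx hF.deriv x t).fun_sub (hpx hF.deriv x t)))]
    have := hA0 x
    have h := hAs x
    simp only [hu]
    rw [← hcdef]
    generalize √(A x) = a at this h ⊢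
    rw [← h]
    field_simp
    ring
  · intro t
    have h := hux hF (0, t)
    have hP0 : p (deriv F) 0 t = r (deriv F) 0 t - deriv F t := by
      simp only [hp, hr, rightWave, sub_zero]
      congr 1
      refine setIntegral_congr_fun measurableSet_Ioi fun s hs ↦ ?_
      simp [hK.eq_P 0 s (le_of_lt hs)]
    simpa [hA.apply_zero, hP0] using h
  · intro x t h
    simp only [hu, hp, hr, rightWave]
    rw [causalConv_eq_zero hF _ _ h, causalConv_eq_zero hF _ _ h, hF.zero _ h]
    simp
  · intro t
    have hP0 : p F 0 t = r F 0 t - F t := by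
      simp only [hp, hr, rightWave, sub_zero]
      congr 1
      refine setIntegral_congr_fun measurableSet_Ioi fun s hs ↦ ?_
      simp [hK.eq_P 0 s (le_of_lt hs)]
    simp only [hu, hP0, hA.apply_zero]
    simp [hr]
    ring

end WaveND

namespace WaveND

open MeasureTheory

/-! ### Distributions given by functions -/

/-- Test functions on the plane. -/
abbrev Test2 := 𝓓((⊤ : TopologicalSpace.Opens (ℝ × ℝ)), ℝ)

theorem mulTest_apply {E : Type*} [NormedAddCommGroup E] [NormedSpace ℝ E]
    {Ω : TopologicalSpace.Opens E} (a : E → ℝ) (ha : ContDiff ℝ ∞ a) (φ : 𝓓(Ω, ℝ)) (x : E) :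
    mulTest a ha φ x = a x * φ x := rfl

/-- A compactly supported smooth function as a test function. -/
def mkTest {E : Type*} [NormedAddCommGroup E] [NormedSpace ℝ E] (f : E → ℝ) (hf : ContDiff ℝ ∞ f)
    (hs : HasCompactSupport f) : 𝓓((⊤ : TopologicalSpace.Opens E), ℝ) where
  toFun := f
  contDiff' := hf
  hasCompactSupport' := hs
  tsupport_subset' := fun _ _ ↦ trivial

theorem mkTest_apply {E : Type*} [NormedAddCommGroup E] [NormedSpace ℝ E] {f : E → ℝ}
    (hf : ContDiff ℝ ∞ f) (hs : HasCompactSupport f) (x : E) : mkTest f hf hs x = f x := rfl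

theorem lineDeriv_test_apply {E : Type*} [NormedAddCommGroup E] [NormedSpace ℝ E]
    (φ : 𝓓((⊤ : TopologicalSpace.Opens E), ℝ)) (v z : E) : (∂_{v} φ) z = fderiv ℝ φ z v := by
  rw [TestFunction.lineDerivOp_eq_lineDerivCLM ℝ, TestFunction.lineDerivCLM_apply]
  simp only [top_add, le_refl, if_true]
  exact (φ.contDiff.differentiable (by simp)).differentiableAt.lineDeriv_eq_fderiv

theorem dx_apply (u : Dist2) (φ : Test2) : dx u φ = -u (∂_{((1 : ℝ), (0 : ℝ))} φ) := by
  rw [dx, Distribution.lineDerivOp_apply_apply, map_neg]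

theorem dt_apply (u : Dist2) (φ : Test2) : dt u φ = -u (∂_{((0 : ℝ), (1 : ℝ))} φ) := by
  rw [dt, Distribution.lineDerivOp_apply_apply, map_neg]

/-- The distributional derivative of a smooth function is its classical derivative. -/
theorem lineDeriv_ofFun {E : Type*} [NormedAddCommGroup E] [NormedSpace ℝ E] [MeasureSpace E]
    [BorelSpace E] [FiniteDimensional ℝ E] [SecondCountableTopology E]
    [(volume : Measure E).IsAddHaarMeasure]
    {w : E → ℂ} (hw : ContDiff ℝ ∞ w) (v : E) :
    (∂_{v} (ofFun w) : 𝓓'((⊤ : TopologicalSpace.Opens E), ℂ)) = ofFun fun z ↦ fderiv ℝ w z v := by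
  have hw' : Continuous fun z ↦ fderiv ℝ w z v := (hw.continuous_fderiv (by simp)).clm_apply
    continuous_const
  ext φ
  rw [Distribution.lineDerivOp_apply_apply, map_neg, ofFun_apply hw.continuous, ofFun_apply hw']
  simp_rw [lineDeriv_test_apply]
  have hφ' : Continuous fun z ↦ fderiv ℝ φ z v := (φ.contDiff.continuous_fderiv (by simp)).clm_apply
    continuous_const
  have hs : HasCompactSupport fun z ↦ fderiv ℝ φ z v := φ.hasCompactSupport.fderiv_apply ℝ v
  rw [integral_smul_fderiv_eq_neg_fderiv_smul_of_integrable (𝕜 := ℝ)]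
  · exact (hφ'.smul hw.continuous).integrable_of_hasCompactSupport hs.smul_right
  · exact (φ.continuous.smul hw').integrable_of_hasCompactSupport φ.hasCompactSupport.smul_right
  · exact (φ.continuous.smul hw.continuous).integrable_of_hasCompactSupport
      φ.hasCompactSupport.smul_right
  · exact fun x _ ↦ (φ.contDiff.differentiable (by simp)).differentiableAt
  · exact fun x _ ↦ (hw.differentiable (by simp)).differentiableAt

/-- The distribution given by a real function. -/
noncomputable def ofReal (u : ℝ × ℝ → ℝ) : Dist2 := ofFun fun z ↦ (u z : ℂ)

theorem contDiff_complex {E : Type*} [NormedAddCommGroup E] [NormedSpace ℝ E] {u : E → ℝ}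
    (hu : ContDiff ℝ ∞ u) : ContDiff ℝ ∞ fun z ↦ (u z : ℂ) :=
  Complex.ofRealCLM.contDiff.comp hu

theorem fderiv_complex {u : ℝ × ℝ → ℝ} (hu : ContDiff ℝ ∞ u) (z v : ℝ × ℝ) :
    fderiv ℝ (fun z ↦ (u z : ℂ)) z v = (fderiv ℝ u z v : ℝ) := by
  have h := Complex.ofRealCLM.hasFDerivAt.comp z
    (hu.differentiable (by simp)).differentiableAt.hasFDerivAt
  have h' : fderiv ℝ (fun z ↦ (u z : ℂ)) z = _ := h.fderiv
  rw [h']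
  simp

theorem dx_ofReal {u : ℝ × ℝ → ℝ} (hu : ContDiff ℝ ∞ u) : dx (ofReal u) = ofReal (pdx u) := by
  rw [dx, ofReal, lineDeriv_ofFun (contDiff_complex hu)]
  simp_rw [fderiv_complex hu]
  rfl

theorem dt_ofReal {u : ℝ × ℝ → ℝ} (hu : ContDiff ℝ ∞ u) : dt (ofReal u) = ofReal (pdt u) := by
  rw [dt, ofReal, lineDeriv_ofFun (contDiff_complex hu)]
  simp_rw [fderiv_complex hu]
  rfl

theorem mulDist_ofReal {a u : ℝ × ℝ → ℝ} (ha : ContDiff ℝ ∞ a) (hu : Continuous u) :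
    mulDist a ha (ofReal u) = ofReal fun z ↦ a z * u z := by
  have hu' : Continuous fun z ↦ (u z : ℂ) := by fun_prop
  have hau : Continuous fun z ↦ ((a z * u z : ℝ) : ℂ) := by
    have := ha.continuous; fun_prop
  ext φ
  rw [mulDist_apply, ofReal, ofReal, ofFun_apply hu', ofFun_apply hau]
  refine integral_congr_ae (.of_forall fun z ↦ ?_)
  simp only [mulTest_apply, Complex.real_smul]
  push_cast
  ring

theorem IsWave.waveOp_eq {A : ℝ → ℝ} (hA : Admissible A) {u : ℝ × ℝ → ℝ} (hu : IsWave A u) :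
    waveOp hA (ofReal u) = 0 := by
  have h1 : ContDiff ℝ ∞ fun z : ℝ × ℝ ↦ A z.1 * pdx u z :=
    hA.smooth_fst.mul (contDiff_pdx hu.smooth)
  rw [waveOp, dt_ofReal hu.smooth, dt_ofReal (contDiff_pdt hu.smooth), dx_ofReal hu.smooth,
    mulDist_ofReal _ (contDiff_pdx hu.smooth).continuous, dx_ofReal h1,
    mulDist_ofReal _ (contDiff_pdx h1).continuous, sub_eq_zero]
  congr 1
  funext z
  rw [← hu.eq, ← mul_assoc, inv_mul_cancel₀ (hA.pos z.1).ne', one_mul]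

/-! ### Wave front sets of smooth functions -/

theorem continuous_phase (ξ : ℝ × ℝ) : Continuous (phase ξ) := (contDiff_phase ξ).continuous

/-- The localized Fourier transform, defined by pairing with the real test functions `φ cos` and
`φ sin`, is the usual integral for a continuous function. -/
theorem localFourier_ofFun (φ : Test2) {w : ℝ × ℝ → ℂ} (hw : Continuous w) (ξ : ℝ × ℝ) :
    localFourier φ (ofFun w) ξ
      = ∫ z, Complex.exp (-(phase ξ z : ℂ) * Complex.I) * ((φ z : ℂ) * w z) := by
  have hi : ∀ {g : ℝ × ℝ → ℝ}, Continuous g → Integrable fun z ↦ (g z * φ z) • w z := fun hg ↦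
    ((hg.mul φ.continuous).smul hw).integrable_of_hasCompactSupport
      (φ.hasCompactSupport.mul_left.smul_right)
  rw [localFourier, ofFun_apply hw, ofFun_apply hw, ← MeasureTheory.integral_const_mul]
  simp_rw [mulTest_apply]
  have hp := continuous_phase ξ
  rw [← integral_sub (hi (by fun_prop)) ((hi (by fun_prop)).const_mul _)]
  refine integral_congr_ae (.of_forall fun z ↦ ?_)
  simp only [Complex.real_smul, neg_mul]
  rw [← neg_mul, Complex.exp_mul_I, Complex.cos_neg, Complex.sin_neg]
  push_cast
  ring

/-- The pairing `(z, ξ) ↦ ⟨ξ, z⟩ / 2π` as a bilinear map. -/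
noncomputable def phaseBilin : (ℝ × ℝ) →L[ℝ] (ℝ × ℝ) →L[ℝ] ℝ :=
  (2 * Real.pi)⁻¹ • ((ContinuousLinearMap.fst ℝ ℝ ℝ).smulRight (ContinuousLinearMap.fst ℝ ℝ ℝ)
    + (ContinuousLinearMap.snd ℝ ℝ ℝ).smulRight (ContinuousLinearMap.snd ℝ ℝ ℝ))

theorem phaseBilin_apply (z ξ : ℝ × ℝ) : phaseBilin z ξ = (2 * Real.pi)⁻¹ * phase ξ z := by
  simp [phaseBilin, phase]
  ring

/-- The Fourier transform without the factor `2π` in the exponent as an instance of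
`VectorFourier.fourierIntegral`. -/
theorem fourierIntegral_phaseBilin (f : ℝ × ℝ → ℂ) (ξ : ℝ × ℝ) :
    VectorFourier.fourierIntegral Real.fourierChar volume phaseBilin.toLinearMap₁₂ f ξ
      = ∫ z, Complex.exp (-(phase ξ z : ℂ) * Complex.I) * f z := by
  rw [VectorFourier.fourierIntegral]
  refine integral_congr_ae (.of_forall fun z ↦ ?_)
  have h : phaseBilin.toLinearMap₁₂ z ξ = (2 * Real.pi)⁻¹ * phase ξ z := phaseBilin_apply z ξ
  simp only [h, Circle.smul_def, Real.fourierChar_apply, smul_eq_mul]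
  congr 2
  push_cast
  have : (Real.pi : ℂ) ≠ 0 := by exact_mod_cast Real.pi_ne_zero
  field_simp

/-- Integration by parts, `n` times in the direction `v`. -/
theorem exists_decay_coordinate {f : ℝ × ℝ → ℂ} (hf : ContDiff ℝ ∞ f) (hs : HasCompactSupport f)
    (n : ℕ) (v : ℝ × ℝ) :
    ∃ C, ∀ ξ : ℝ × ℝ, |phase ξ v| ^ n *
      ‖∫ z, Complex.exp (-(phase ξ z : ℂ) * Complex.I) * f z‖ ≤ C := by
  have hint : ∀ k n : ℕ, Integrable fun v ↦ ‖v‖ ^ k * ‖iteratedFDeriv ℝ n f v‖ := by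
    intro k n
    refine Continuous.integrable_of_hasCompactSupport ?_ (hs.iteratedFDeriv n).norm.mul_left
    exact (continuous_norm.pow k).mul (hf.continuous_iteratedFDeriv (by exact_mod_cast le_top)).norm
  refine ⟨(2 * Real.pi) ^ n * (‖v‖ ^ n * (2 * Real.pi * ‖phaseBilin‖) ^ 0 * (2 * (0 : ℕ) + 2) ^ n *
    ∑ p ∈ Finset.range (0 + 1) ×ˢ Finset.range (n + 1),
      ∫ v, ‖v‖ ^ p.1 * ‖iteratedFDeriv ℝ p.2 f v‖), fun ξ ↦ ?_⟩
  have h := VectorFourier.pow_mul_norm_iteratedFDeriv_fourierIntegral_le phaseBilin (μ := volume)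
    (K := ⊤) (N := ⊤) hf (fun k n _ _ ↦ hint k n) (k := 0) (n := n) le_top le_top v ξ
  rw [norm_iteratedFDeriv_zero, fourierIntegral_phaseBilin, phaseBilin_apply, abs_mul, mul_pow,
    abs_of_pos (by positivity), mul_assoc, inv_pow, inv_mul_le_iff₀ (by positivity)] at h
  exact h

theorem sqrt_one_add_covNorm_le (ξ : ℝ × ℝ) :
    √(1 + covNorm ξ ^ 2) ≤ 1 + |ξ.1| + |ξ.2| := by
  refine Real.sqrt_le_iff.2 ⟨by positivity, ?_⟩
  rw [covNorm, Real.sq_sqrt (by positivity), ← sq_abs ξ.1, ← sq_abs ξ.2]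
  nlinarith [abs_nonneg ξ.1, abs_nonneg ξ.2, mul_nonneg (abs_nonneg ξ.1) (abs_nonneg ξ.2)]

theorem add_pow_le_three {a b : ℝ} (ha : 0 ≤ a) (hb : 0 ≤ b) (N : ℕ) :
    (1 + a + b) ^ N ≤ 3 ^ N * (1 + a ^ N + b ^ N) := by
  set m := max 1 (max a b)
  have h1 : 1 ≤ m := le_max_left _ _
  have h2 : a ≤ m := (le_max_left _ _).trans (le_max_right _ _)
  have h3 : b ≤ m := (le_max_right _ _).trans (le_max_right _ _)
  calc (1 + a + b) ^ N ≤ (3 * m) ^ N := by gcongr; linarith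
    _ = 3 ^ N * m ^ N := mul_pow _ _ _
    _ ≤ _ := by
      gcongr
      have ha' : 0 ≤ a ^ N := by positivity
      have hb' : 0 ≤ b ^ N := by positivity
      rcases max_choice 1 (max a b) with h | h
      · simp only [m, h, one_pow]; linarith
      · rcases max_choice a b with h' | h' <;> simp only [m, h, h'] <;> linarith

/-- The Fourier transform of a smooth compactly supported function decays rapidly. -/
theorem exists_decay {f : ℝ × ℝ → ℂ} (hf : ContDiff ℝ ∞ f) (hs : HasCompactSupport f) (N : ℕ) :
    ∃ C, ∀ ξ : ℝ × ℝ, √(1 + covNorm ξ ^ 2) ^ N *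
      ‖∫ z, Complex.exp (-(phase ξ z : ℂ) * Complex.I) * f z‖ ≤ C := by
  obtain ⟨C₀, h₀⟩ := exists_decay_coordinate hf hs 0 0
  obtain ⟨C₁, h₁⟩ := exists_decay_coordinate hf hs N (1, 0)
  obtain ⟨C₂, h₂⟩ := exists_decay_coordinate hf hs N (0, 1)
  refine ⟨3 ^ N * (C₀ + C₁ + C₂), fun ξ ↦ ?_⟩
  specialize h₀ ξ; specialize h₁ ξ; specialize h₂ ξ
  simp only [phase, mul_one, mul_zero, add_zero, zero_add, pow_zero, one_mul] at h₀ h₁ h₂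
  simp only [phase]
  set J := ‖∫ z : ℝ × ℝ, Complex.exp (-((ξ.1 * z.1 + ξ.2 * z.2 : ℝ) : ℂ) * Complex.I) * f z‖
  calc √(1 + covNorm ξ ^ 2) ^ N * J ≤ (1 + |ξ.1| + |ξ.2|) ^ N * J := by
        gcongr; exact sqrt_one_add_covNorm_le ξ
    _ ≤ 3 ^ N * (1 + |ξ.1| ^ N + |ξ.2| ^ N) * J := by
        gcongr; exact add_pow_le_three (abs_nonneg _) (abs_nonneg _) N
    _ = 3 ^ N * (J + |ξ.1| ^ N * J + |ξ.2| ^ N * J) := by ring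
    _ ≤ _ := by gcongr

theorem exists_decay_localFourier (φ : Test2) {w : ℝ × ℝ → ℂ} (hw : ContDiff ℝ ∞ w) (N : ℕ) :
    ∃ C, ∀ ξ : ℝ × ℝ, √(1 + covNorm ξ ^ 2) ^ N * ‖localFourier φ (ofFun w) ξ‖ ≤ C := by
  simp_rw [localFourier_ofFun φ hw.continuous]
  have hs : HasCompactSupport fun z ↦ (φ z : ℂ) :=
    φ.hasCompactSupport.comp_left (g := ((↑) : ℝ → ℂ)) Complex.ofReal_zero
  exact exists_decay ((contDiff_complex φ.contDiff).mul hw) hs.mul_right N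

/-- A smooth function has empty wave front set. -/
theorem ofFun_mem_DSigma {w : ℝ × ℝ → ℂ} (hw : ContDiff ℝ ∞ w) : ofFun w ∈ DSigma := by
  rintro ⟨z, ξ⟩ ⟨hξ, h⟩
  refine absurd ?_ h
  obtain ⟨f, -, hfs, hf, -, hfz⟩ := exists_contDiff_tsupport_subset (n := ⊤) (x := z)
    (s := Set.univ) Filter.univ_mem
  refine ⟨mkTest f hf hfs, {0}ᶜ, by simp [mkTest_apply, hfz], isOpen_compl_singleton, ?_, by simp,
    hξ, fun N ↦ ?_⟩
  · intro r hr η hη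
    exact smul_ne_zero hr.ne' hη
  · obtain ⟨C, hC⟩ := exists_decay_localFourier (mkTest f hf hfs) hw N
    exact ⟨C, fun ξ _ ↦ hC ξ⟩

theorem localFourier_zero (φ : Test2) (ξ : ℝ × ℝ) : localFourier φ 0 ξ = 0 := by
  simp [localFourier]

/-- The trace of a smooth function is its restriction, by the constant approximating sequence. -/
theorem isBoundaryTrace_ofFun {w : ℝ × ℝ → ℂ} (hw : ContDiff ℝ ∞ w) :
    IsBoundaryTrace (ofFun w) (ofFun fun t ↦ w (0, t)) := by
  refine ⟨fun _ ↦ w, fun _ ↦ hw, ⟨fun _ ↦ tendsto_const_nhds, ?_⟩, fun _ ↦ tendsto_const_nhds⟩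
  intro N φ Γ _ _ _ ε hε
  refine .of_forall fun j ξ _ ↦ ?_
  rw [sub_self, localFourier_zero, norm_zero, mul_zero]
  exact hε.le

/-! ### Neumann and Dirichlet data of smooth solutions -/

theorem dsupport_ofFun_subset {w : ℝ → ℂ} (hw : Continuous w) :
    Distribution.dsupport (ofFun w) ⊆ tsupport w := by
  refine Set.sInter_subset_of_mem ⟨fun φ hφ ↦ ?_, isClosed_tsupport w⟩
  rw [ofFun_apply hw, ← integral_zero ℝ ℂ]
  refine integral_congr_ae (.of_forall fun t ↦ ?_)
  by_cases ht : t ∈ tsupport w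
  · have : φ t = 0 := image_eq_zero_of_notMem_tsupport fun h ↦ hφ h ht
    simp [this]
  · simp [image_eq_zero_of_notMem_tsupport ht]

theorem ofReal_isVanishingOn {u : ℝ × ℝ → ℝ} (hu : Continuous u) {s : Set (ℝ × ℝ)}
    (h : ∀ z ∈ s, u z = 0) : Distribution.IsVanishingOn (ofReal u) s := by
  intro φ hφ
  rw [ofReal, ofFun_apply (by fun_prop), ← integral_zero (ℝ × ℝ) ℂ]
  refine integral_congr_ae (.of_forall fun z ↦ ?_)
  by_cases hz : z ∈ s
  · simp [h z hz]
  · have : φ z = 0 := image_eq_zero_of_notMem_tsupport fun h ↦ hz (hφ h)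
    simp [this]

theorem IsSource.tsupport_subset {t₀ : ℝ} {F : ℝ → ℝ} (hF : IsSource t₀ F) :
    tsupport F ⊆ Set.Ici t₀ := by
  refine closure_minimal (fun t ht ↦ ?_) isClosed_Ici
  by_contra h
  exact ht (hF.zero t (not_le.1 h))

/-- A smooth solution of the mixed problem yields a pair of Neumann and Dirichlet data. -/
theorem IsWave.isNDPair {A : ℝ → ℝ} (hA : Admissible A) {u : ℝ × ℝ → ℝ} (hu : IsWave A u) {t₀ : ℝ}
    {f : ℝ → ℝ} (hf : IsSource t₀ f) (hN : ∀ t, pdx u (0, t) = f t)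
    (h0 : ∀ x t, t - x < t₀ → u (x, t) = 0) :
    IsNDPair hA (ofFun fun t ↦ (f t : ℂ)) (ofFun fun t ↦ (u (0, t) : ℂ)) := by
  have hfc : Continuous fun t ↦ (f t : ℂ) := (contDiff_complex hf.smooth).continuous
  refine ⟨t₀ - 1, ofReal u, ?_, ⟨ofFun_mem_DSigma (contDiff_complex hu.smooth), ?_, ?_, ?_⟩,
    isBoundaryTrace_ofFun (contDiff_complex hu.smooth)⟩
  · refine (dsupport_ofFun_subset hfc).trans fun t ht ↦ ?_
    have : t ∈ tsupport f := closure_mono (fun s hs ↦ by simpa using hs) ht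
    exact lt_of_lt_of_le (show t₀ - 1 < t₀ by linarith) (hf.tsupport_subset this)
  · rw [hu.waveOp_eq hA]
    exact fun _ _ ↦ rfl
  · exact ofReal_isVanishingOn hu.smooth.continuous fun z hz ↦
      h0 z.1 z.2 (by have := hz.1; have := hz.2; linarith)
  · rw [dx_ofReal hu.smooth]
    have := isBoundaryTrace_ofFun (contDiff_complex (contDiff_pdx hu.smooth))
    simp_rw [hN] at this
    exact this

/-- The map is defined by a choice among all solutions; the value is only known to be the Dirichlet
data of some distributional solution. -/
theorem isNDPair_neumannToDirichlet {A : ℝ → ℝ} (hA : Admissible A) {f : Dist1}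
    (h : ∃ g, IsNDPair hA f g) : IsNDPair hA f (neumannToDirichlet hA f) := by
  rw [neumannToDirichlet, dif_pos h]
  exact h.choose_spec

/-! ### The trace as a limit of averages -/

/-- The integral over vertical lines of `φ w`. -/
noncomputable def lineMean (φ : Test2) (w : ℝ × ℝ → ℂ) (x : ℝ) : ℂ := ∫ t, (φ (x, t) : ℂ) * w (x, t)

theorem exists_box (φ : Test2) : ∃ B, 0 < B ∧ ∀ x t, φ (x, t) ≠ 0 → |x| ≤ B ∧ |t| ≤ B := by
  obtain ⟨B, hB0, hB⟩ := φ.hasCompactSupport.isCompact.isBounded.exists_pos_norm_le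
  refine ⟨B, hB0, fun x t h ↦ ?_⟩
  have := hB (x, t) (subset_tsupport _ h)
  exact ⟨(norm_fst_le (x, t)).trans this, (norm_snd_le (x, t)).trans this⟩

theorem lineMean_eq_zero {φ : Test2} {B : ℝ} (hB : ∀ x t, φ (x, t) ≠ 0 → |x| ≤ B ∧ |t| ≤ B)
    (w : ℝ × ℝ → ℂ) {x : ℝ} (hx : B < |x|) : lineMean φ w x = 0 := by
  have : ∀ t, φ (x, t) = 0 := fun t ↦ by
    by_contra h
    exact absurd (hB x t h).1 (not_le.2 hx)
  simp [lineMean, this]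

theorem continuous_lineMean (φ : Test2) {w : ℝ × ℝ → ℂ} (hw : Continuous w) :
    Continuous (lineMean φ w) := by
  obtain ⟨B, -, hB⟩ := exists_box φ
  have h : lineMean φ w = fun x ↦ ∫ t in Set.Icc (-B) B, (φ (x, t) : ℂ) * w (x, t) := by
    funext x
    refine (setIntegral_eq_integral_of_forall_compl_eq_zero fun t ht ↦ ?_).symm
    have : φ (x, t) = 0 := by
      by_contra h
      exact ht (abs_le.1 (hB x t h).2)
    simp [this]
  rw [h]
  have := φ.continuous
  exact continuous_parametric_integral_of_continuous
    (f := fun x t ↦ (φ (x, t) : ℂ) * w (x, t)) (by simp only [Function.uncurry_def]; fun_prop)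
    isCompact_Icc

theorem integrable_lineMean (φ : Test2) {w : ℝ × ℝ → ℂ} (hw : Continuous w) :
    Integrable (lineMean φ w) := by
  obtain ⟨B, -, hB⟩ := exists_box φ
  refine (continuous_lineMean φ hw).integrable_of_hasCompactSupport
    (HasCompactSupport.intro (isCompact_Icc (a := -B) (b := B)) fun x hx ↦ ?_)
  exact lineMean_eq_zero hB w (not_le.1 fun h ↦ hx (abs_le.1 h))

theorem integrable_test_mul (φ : Test2) {w : ℝ × ℝ → ℂ} (hw : Continuous w) :
    Integrable fun z ↦ (φ z : ℂ) * w z := by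
  have := φ.continuous
  exact (by fun_prop : Continuous fun z ↦ (φ z : ℂ) * w z).integrable_of_hasCompactSupport
    (φ.hasCompactSupport.comp_left (g := ((↑) : ℝ → ℂ)) Complex.ofReal_zero).mul_right

/-- Fubini's theorem for a factor depending on `x` only. -/
theorem integral_fst_mul (φ : Test2) {w : ℝ × ℝ → ℂ} (hw : Continuous w) {e : ℝ → ℂ}
    (he : Continuous e) :
    ∫ z : ℝ × ℝ, e z.1 * ((φ z : ℂ) * w z) = ∫ x, e x * lineMean φ w x := by
  have hi : Integrable fun z : ℝ × ℝ ↦ e z.1 * ((φ z : ℂ) * w z) := by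
    have := integrable_test_mul φ (w := fun z ↦ e z.1 * w z) (by fun_prop)
    refine this.congr (.of_forall fun z ↦ by ring)
  rw [Measure.volume_eq_prod, integral_prod _ (by rwa [← Measure.volume_eq_prod])]
  refine integral_congr_ae (.of_forall fun x ↦ ?_)
  exact integral_const_mul (e x) fun t ↦ (φ (x, t) : ℂ) * w (x, t)

/-- The Fourier transform of the line means only involves the codirections `(s, 0)`, conormal to the
lines. -/
theorem fourier_lineMean (φ : Test2) {w : ℝ × ℝ → ℂ} (hw : Continuous w) (k : ℝ) :
    FourierTransform.fourier (lineMean φ w) k = localFourier φ (ofFun w) (2 * Real.pi * k, 0) := by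
  rw [localFourier_ofFun φ hw, Real.fourier_eq']
  have h := integral_fst_mul φ hw
    (e := fun x ↦ Complex.exp (-((2 * Real.pi * k * x : ℝ) : ℂ) * Complex.I)) (by fun_prop)
  simp only [phase, zero_mul, add_zero]
  rw [h]
  refine integral_congr_ae (.of_forall fun x ↦ ?_)
  simp only [smul_eq_mul]
  congr 2
  simp
  ring

/-- A bound for the line means by the Fourier transform at the codirections `(s, 0)`, from the
Fourier inversion formula. -/
theorem norm_lineMean_le (φ : Test2) {w : ℝ × ℝ → ℂ} (hw : Continuous w) {ε : ℝ}
    (h : ∀ s : ℝ, (1 + s ^ 2) * ‖localFourier φ (ofFun w) (s, 0)‖ ≤ ε) (x : ℝ) :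
    ‖lineMean φ w x‖ ≤ ε * ∫ k : ℝ, (1 + (2 * Real.pi * k) ^ 2)⁻¹ := by
  set m := lineMean φ w
  have hm : Integrable m := integrable_lineMean φ hw
  have hb : ∀ k, ‖FourierTransform.fourier m k‖ ≤ ε * (1 + (2 * Real.pi * k) ^ 2)⁻¹ := by
    intro k
    rw [fourier_lineMean φ hw, ← div_eq_mul_inv, le_div_iff₀ (by positivity), mul_comm]
    exact h _
  have hI : Integrable fun k : ℝ ↦ ε * (1 + (2 * Real.pi * k) ^ 2)⁻¹ :=
    (integrable_inv_one_add_sq.comp_mul_left' (by positivity)).const_mul ε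
  have hFc : Continuous (FourierTransform.fourier m) :=
    VectorFourier.fourierIntegral_continuous Real.continuous_fourierChar
      (by exact continuous_inner) hm
  have hF : Integrable (FourierTransform.fourier m) :=
    hI.mono' hFc.aestronglyMeasurable (.of_forall hb)
  have hinv := congrFun ((continuous_lineMean φ hw).fourierInv_fourier_eq hm hF) x
  rw [show m x = _ from hinv.symm, Real.fourierInv_eq, ← integral_const_mul]
  refine (norm_integral_le_integral_norm _).trans (integral_mono_of_nonneg
    (.of_forall fun _ ↦ norm_nonneg _) hI (.of_forall fun k ↦ ?_))
  simp only [Circle.norm_smul]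
  exact hb k

end WaveND

namespace WaveND

open MeasureTheory Filter

theorem localFourier_sub (φ : Test2) (u v : Dist2) (ξ : ℝ × ℝ) :
    localFourier φ (u - v) ξ = localFourier φ u ξ - localFourier φ v ξ := by
  simp only [localFourier, sub_apply]
  ring

theorem ofFun_sub {v w : ℝ × ℝ → ℂ} (hv : Continuous v) (hw : Continuous w) :
    ofFun (fun z ↦ v z - w z) = ofFun v - ofFun w := by
  ext φ
  have hi : ∀ {v : ℝ × ℝ → ℂ}, Continuous v → Integrable fun z ↦ φ z • v z := fun hv ↦
    (φ.continuous.smul hv).integrable_of_hasCompactSupport φ.hasCompactSupport.smul_right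
  rw [sub_apply, ofFun_apply (hv.fun_sub hw), ofFun_apply hv, ofFun_apply hw,
    ← integral_sub (hi hv) (hi hw)]
  simp_rw [smul_sub]

theorem lineMean_sub (φ : Test2) {v w : ℝ × ℝ → ℂ} (hv : Continuous v) (hw : Continuous w) (x : ℝ) :
    lineMean φ (fun z ↦ v z - w z) x = lineMean φ v x - lineMean φ w x := by
  obtain ⟨B, -, hB⟩ := exists_box φ
  have hφ := φ.continuous
  have hi : ∀ {v : ℝ × ℝ → ℂ}, Continuous v → Integrable fun t ↦ (φ (x, t) : ℂ) * v (x, t) := by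
    intro v hv
    have hφv : Continuous fun t ↦ (φ (x, t) : ℂ) * v (x, t) := by fun_prop
    refine hφv.integrable_of_hasCompactSupport
      (HasCompactSupport.intro (isCompact_Icc (a := -B) (b := B)) fun t ht ↦ ?_)
    have : φ (x, t) = 0 := by
      by_contra h
      exact ht (abs_le.1 (hB x t h).2)
    simp [this]
  rw [lineMean, lineMean, lineMean, ← integral_sub (hi hv) (hi hw)]
  simp_rw [mul_sub]

/-- The restriction of a test function to the time axis `x = 0`. -/
noncomputable def slice (φ : Test2) : 𝓓((⊤ : TopologicalSpace.Opens ℝ), ℝ) :=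
  mkTest (fun t ↦ φ (0, t)) (φ.contDiff.comp (contDiff_const.prodMk contDiff_id)) (by
    obtain ⟨B, -, hB⟩ := exists_box φ
    refine HasCompactSupport.intro (isCompact_Icc (a := -B) (b := B)) fun t ht ↦ ?_
    by_contra h
    exact ht (abs_le.1 (hB 0 t h).2))

theorem slice_apply (φ : Test2) (t : ℝ) : slice φ t = φ (0, t) := rfl

theorem ofFun_slice (φ : Test2) {w : ℝ × ℝ → ℂ} (hw : Continuous w) :
    ofFun (fun t ↦ w (0, t)) (slice φ) = lineMean φ w 0 := by
  rw [ofFun_apply (by fun_prop), lineMean]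
  simp_rw [slice_apply, Complex.real_smul]

theorem ofFun_mulTest_fst (φ : Test2) {w : ℝ × ℝ → ℂ} (hw : Continuous w) {χ : ℝ → ℝ}
    (hχ : ContDiff ℝ ∞ χ) :
    ofFun w (mulTest (fun z ↦ χ z.1) (hχ.comp contDiff_fst) φ)
      = ∫ x, (χ x : ℂ) * lineMean φ w x := by
  have := hχ.continuous
  rw [ofFun_apply hw, ← integral_fst_mul φ hw (e := fun x ↦ (χ x : ℂ)) (by fun_prop)]
  refine integral_congr_ae (.of_forall fun z ↦ ?_)
  simp only [mulTest_apply, Complex.real_smul]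
  push_cast
  ring

theorem covNorm_fst_sq (s : ℝ) : covNorm (s, 0) ^ 2 = s ^ 2 := by
  simp [covNorm, Real.sq_sqrt (sq_nonneg s)]

/-- The codirections `(s, 0)` are never characteristic, so that convergence in `𝓓'_Σ` controls
the line means uniformly. -/
theorem TendstoDSigma.eventually_le {v : ℕ → Dist2} {u : Dist2} (h : TendstoDSigma v u) (φ : Test2)
    {ε : ℝ} (hε : 0 < ε) :
    ∀ᶠ j in atTop, ∀ s : ℝ, (1 + s ^ 2) * ‖localFourier φ (u - v j) (s, 0)‖ ≤ 2 * ε := by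
  set Γ : Set (ℝ × ℝ) := {ξ | ξ.2 = 0}
  have hΓ : IsClosed Γ := isClosed_eq continuous_snd continuous_const
  have hcone : IsConic Γ := fun r _ ξ hξ ↦ by
    simp only [Γ, Set.mem_ofPred_eq] at hξ ⊢
    simp [hξ]
  have hdisj : Disjoint (tsupport φ ×ˢ Γ) charVariety := by
    refine Set.disjoint_left.2 ?_
    rintro ⟨z, ξ⟩ ⟨-, hξ⟩ ⟨hξ0, hξ'⟩
    simp only [Γ, Set.mem_ofPred_eq] at hξ hξ'
    refine hξ0 (Prod.ext ?_ hξ)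
    rw [hξ] at hξ'
    simpa using hξ'.symm
  filter_upwards [h.2 0 φ Γ hΓ hcone hdisj ε hε, h.2 2 φ Γ hΓ hcone hdisj ε hε] with j h0 h2 s
  have h0' := h0 (s, 0) rfl
  have h2' := h2 (s, 0) rfl
  rw [covNorm_fst_sq] at h2'
  rw [pow_zero, one_mul] at h0'
  linarith

/-- If `u` has the boundary trace `g`, then the vertical line means of `φ u` are a continuous
function of `x` whose value at `0` is given by `g`. -/
theorem IsBoundaryTrace.exists_lineMean {u : Dist2} {g : Dist1} (h : IsBoundaryTrace u g)
    (φ : Test2) :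
    ∃ m : ℝ → ℂ, Continuous m ∧ m 0 = g (slice φ) ∧ ∀ (χ : ℝ → ℝ) (hχ : ContDiff ℝ ∞ χ),
      u (mulTest (fun z ↦ χ z.1) (hχ.comp contDiff_fst) φ) = ∫ x, (χ x : ℂ) * m x := by
  obtain ⟨v, hv, hvu, hvg⟩ := h
  have hvc := fun j ↦ (hv j).continuous
  set I : ℝ := ∫ k : ℝ, (1 + (2 * Real.pi * k) ^ 2)⁻¹
  have hI : 0 ≤ I := integral_nonneg fun k ↦ by positivity
  have hcau : ∀ ε > 0, ∃ N, ∀ j ≥ N, ∀ k ≥ N, ∀ x,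
      dist (lineMean φ (v j) x) (lineMean φ (v k) x) < ε := by
    intro ε hε
    obtain ⟨N, hN⟩ := eventually_atTop.1
      (hvu.eventually_le φ (ε := ε / (8 * (I + 1))) (by positivity))
    refine ⟨N, fun j hj k hk x ↦ ?_⟩
    rw [dist_eq_norm, ← lineMean_sub φ (hvc j) (hvc k)]
    refine (norm_lineMean_le φ ((hvc j).fun_sub (hvc k)) (ε := 4 * (ε / (8 * (I + 1))))
      (fun s ↦ ?_) x).trans_lt ?_
    · have e : localFourier φ (ofFun (fun z ↦ v j z - v k z)) (s, 0)
          = localFourier φ (u - ofFun (v k)) (s, 0) - localFourier φ (u - ofFun (v j)) (s, 0) := by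
        rw [ofFun_sub (hvc j) (hvc k)]
        simp only [localFourier_sub]
        ring
      rw [e]
      calc (1 + s ^ 2) * ‖localFourier φ (u - ofFun (v k)) (s, 0)
              - localFourier φ (u - ofFun (v j)) (s, 0)‖
          ≤ (1 + s ^ 2) * (‖localFourier φ (u - ofFun (v k)) (s, 0)‖
              + ‖localFourier φ (u - ofFun (v j)) (s, 0)‖) := by
            gcongr; exact norm_sub_le _ _
        _ ≤ _ := by linarith [hN j hj s, hN k hk s]
    · change 4 * (ε / (8 * (I + 1))) * I < ε
      have : 4 * (ε / (8 * (I + 1))) * I = ε * (I / (2 * (I + 1))) := by field_simp; ring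
      rw [this]
      have h2 : I / (2 * (I + 1)) < 1 := by rw [div_lt_one (by positivity)]; linarith
      nlinarith
  have hpt : ∀ x, ∃ y, Tendsto (fun j ↦ lineMean φ (v j) x) atTop (𝓝 y) := by
    intro x
    refine cauchySeq_tendsto_of_complete (Metric.cauchySeq_iff.2 fun ε hε ↦ ?_)
    obtain ⟨N, hN⟩ := hcau ε hε
    exact ⟨N, fun j hj k hk ↦ hN j hj k hk x⟩
  choose m hm using hpt
  have hunif : TendstoUniformly (fun j ↦ lineMean φ (v j)) m atTop := by
    rw [← tendstoUniformlyOn_univ]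
    refine UniformCauchySeqOn.tendstoUniformlyOn_of_tendsto
      (Metric.uniformCauchySeqOn_iff.2 fun ε hε ↦ ?_) fun x _ ↦ hm x
    obtain ⟨N, hN⟩ := hcau ε hε
    exact ⟨N, fun j hj k hk x _ ↦ hN j hj k hk x⟩
  have hmc : Continuous m := hunif.continuous
    (Frequently.of_forall fun j ↦ continuous_lineMean φ (hvc j))
  refine ⟨m, hmc, ?_, fun χ hχ ↦ ?_⟩
  · have h1 := hvg (slice φ)
    simp_rw [fun j ↦ ofFun_slice φ (hvc j)] at h1
    exact tendsto_nhds_unique (hm 0) h1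
  · obtain ⟨B, hB0, hB⟩ := exists_box φ
    have hout : ∀ x, x ∉ Set.Icc (-B) B → m x = 0 := fun x hx ↦ by
      refine tendsto_nhds_unique (hm x) ?_
      simp_rw [fun j ↦ lineMean_eq_zero hB (v j) (not_le.1 fun h ↦ hx (abs_le.1 h))]
      exact tendsto_const_nhds
    have hχc := hχ.continuous
    obtain ⟨C, hC⟩ := (isCompact_Icc (a := -B) (b := B)).exists_bound_of_continuousOn
      hχc.continuousOn
    have h1 := hvu.1 (mulTest (fun z ↦ χ z.1) (hχ.comp contDiff_fst) φ)
    simp_rw [fun j ↦ ofFun_mulTest_fst φ (hvc j) hχ] at h1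
    refine tendsto_nhds_unique h1 ?_
    refine tendsto_integral_filter_of_dominated_convergence
      (Set.indicator (Set.Icc (-B) B) fun x ↦ C * (‖m x‖ + 1)) ?_ ?_ ?_ ?_
    · have := fun j ↦ continuous_lineMean φ (hvc j)
      exact .of_forall fun j ↦ (by fun_prop :
        Continuous fun x ↦ (χ x : ℂ) * lineMean φ (v j) x).aestronglyMeasurable
    · filter_upwards [Metric.tendstoUniformly_iff.1 hunif 1 one_pos] with j hj
      refine .of_forall fun x ↦ ?_
      by_cases hx : x ∈ Set.Icc (-B) B
      · rw [Set.indicator_of_mem hx, norm_mul, Complex.norm_real]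
        have h2 := hj x
        rw [dist_comm, dist_eq_norm] at h2
        have h3 := norm_le_norm_add_norm_sub' (lineMean φ (v j) x) (m x)
        have h4 := hC x hx
        have h5 : 0 ≤ ‖χ x‖ := norm_nonneg _
        gcongr
        · linarith
        · linarith
      · rw [Set.indicator_of_notMem hx,
          lineMean_eq_zero hB (v j) (not_le.1 fun h ↦ hx (abs_le.1 h))]
        simp
    · exact (Continuous.integrableOn_Icc (by fun_prop)).integrable_indicator measurableSet_Icc
    · exact .of_forall fun x ↦ (hm x).const_mul _

/-! ### Approximate identities at the boundary -/

/-- Smooth averages over `[r, 3r]`. The support stays in `x > 0`, where the equation is known. -/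
structure IsAverage (r : ℝ) (ρ : ℝ → ℝ) : Prop where
  smooth : ContDiff ℝ ∞ ρ
  nonneg : ∀ x, 0 ≤ ρ x
  zero : ∀ x, x ∉ Set.Icc r (3 * r) → ρ x = 0
  integral : ∫ x, ρ x = 1

theorem exists_isAverage {r : ℝ} (hr : 0 < r) : ∃ ρ, IsAverage r ρ := by
  let f : ContDiffBump (2 * r) := ⟨r / 2, r, by linarith, by linarith⟩
  refine ⟨f.normed volume, f.contDiff_normed, fun x ↦ f.nonneg_normed x, fun x hx ↦ ?_,
    f.integral_normed⟩
  by_contra h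
  have h1 : x ∈ Function.support (f.normed volume) := h
  rw [f.support_normed_eq, Metric.mem_ball, Real.dist_eq, abs_lt] at h1
  have h2 : f.rOut = r := rfl
  rw [h2] at h1
  exact hx ⟨by linarith, by linarith⟩

theorem IsAverage.integrable {r : ℝ} {ρ : ℝ → ℝ} (h : IsAverage r ρ) : Integrable ρ :=
  h.smooth.continuous.integrable_of_hasCompactSupport (HasCompactSupport.intro isCompact_Icc h.zero)

theorem IsAverage.exists_primitive {r : ℝ} (hr : 0 < r) {ρ : ℝ → ℝ} (h : IsAverage r ρ) :
    ∃ θ : ℝ → ℝ, ContDiff ℝ ∞ θ ∧ (∀ x, HasDerivAt θ (ρ x) x) ∧ ∀ x < r, θ x = 0 := by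
  have hc := h.smooth.continuous
  have hd : ∀ x, HasDerivAt (fun x ↦ ∫ y in (0 : ℝ)..x, ρ y) (ρ x) x := fun x ↦
    intervalIntegral.integral_hasDerivAt_right (hc.intervalIntegrable _ _)
      hc.aestronglyMeasurable.stronglyMeasurableAtFilter hc.continuousAt
  refine ⟨fun x ↦ ∫ y in (0 : ℝ)..x, ρ y, ?_, hd, fun x hx ↦ ?_⟩
  · rw [contDiff_infty_iff_deriv]
    refine ⟨fun x ↦ (hd x).differentiableAt, ?_⟩
    rw [funext fun x ↦ (hd x).deriv]
    exact h.smooth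
  · refine (intervalIntegral.integral_congr (g := fun _ ↦ (0 : ℝ)) fun y hy ↦ h.zero y
      fun hy' ↦ ?_).trans intervalIntegral.integral_zero
    have := hy.2
    have h2 : max 0 x < r := max_lt hr hx
    linarith [hy'.1]

theorem IsAverage.norm_integral_sub_le {r ε : ℝ} {ρ : ℝ → ℝ} (h : IsAverage r ρ) {m : ℝ → ℂ}
    (hm : Continuous m) (hε : ∀ x ∈ Set.Icc r (3 * r), ‖m x - m 0‖ ≤ ε) :
    ‖(∫ x, (ρ x : ℂ) * m x) - m 0‖ ≤ ε := by
  have hc := h.smooth.continuous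
  have hi : Integrable fun x ↦ (ρ x : ℂ) * m x :=
    (by fun_prop : Continuous fun x ↦ (ρ x : ℂ) * m x).integrable_of_hasCompactSupport
      (HasCompactSupport.intro (isCompact_Icc (a := r) (b := 3 * r)) fun x hx ↦ by
        simp [h.zero x hx])
  have h1 : ∫ x, (ρ x : ℂ) * m 0 = m 0 := by
    rw [integral_mul_const, integral_complex_ofReal, h.integral]
    simp
  have hi0 : Integrable fun x ↦ (ρ x : ℂ) * m 0 := h.integrable.ofReal.mul_const _
  rw [← h1, ← integral_sub hi hi0]
  calc ‖∫ x, ((ρ x : ℂ) * m x - (ρ x : ℂ) * m 0)‖ ≤ ∫ x, ρ x * ε := by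
        refine norm_integral_le_of_norm_le (h.integrable.mul_const ε) (.of_forall fun x ↦ ?_)
        rw [← mul_sub, norm_mul, Complex.norm_real, Real.norm_of_nonneg (h.nonneg x)]
        by_cases hx : x ∈ Set.Icc r (3 * r)
        · exact mul_le_mul_of_nonneg_left (hε x hx) (h.nonneg x)
        · simp [h.zero x hx]
    _ = ε := by rw [integral_mul_const, h.integral, one_mul]

theorem tendsto_integral_average {r : ℕ → ℝ} (hr : ∀ n, 0 < r n) (hr0 : Tendsto r atTop (𝓝 0))
    {ρ : ℕ → ℝ → ℝ} (h : ∀ n, IsAverage (r n) (ρ n)) {m : ℝ → ℂ} (hm : Continuous m) :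
    Tendsto (fun n ↦ ∫ x, (ρ n x : ℂ) * m x) atTop (𝓝 (m 0)) := by
  rw [Metric.tendsto_atTop']
  intro ε hε
  obtain ⟨δ, hδ, hmδ⟩ := Metric.continuousAt_iff.1 hm.continuousAt (ε / 2) (half_pos hε)
  obtain ⟨N, hN⟩ := eventually_atTop.1 (hr0.eventually_lt_const (show 0 < δ / 3 by positivity))
  refine ⟨N, fun n hn ↦ ?_⟩
  rw [dist_eq_norm]
  refine ((h n).norm_integral_sub_le hm (ε := ε / 2) fun x hx ↦ ?_).trans_lt (by linarith)
  rw [← dist_eq_norm]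
  refine (hmδ ?_).le
  have := hN n hn.le
  rw [Real.dist_eq, sub_zero, abs_lt]
  exact ⟨by linarith [hr n, hx.1], by linarith [hx.2]⟩

theorem IsBoundaryTrace.tendsto_average {u : Dist2} {g : Dist1} (hu : IsBoundaryTrace u g)
    {r : ℕ → ℝ} (hr : ∀ n, 0 < r n) (hr0 : Tendsto r atTop (𝓝 0))
    {ρ : ℕ → ℝ → ℝ} (h : ∀ n, IsAverage (r n) (ρ n)) (φ : Test2) :
    Tendsto (fun n ↦ u (mulTest (fun z ↦ ρ n z.1) ((h n).smooth.comp contDiff_fst) φ)) atTop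
      (𝓝 (g (slice φ))) := by
  obtain ⟨m, hm, hm0, hmu⟩ := hu.exists_lineMean φ
  simp_rw [fun n ↦ hmu (ρ n) (h n).smooth, ← hm0]
  exact tendsto_integral_average hr hr0 h hm

/-! ### Green's identity -/

theorem pdx_mul {f g : ℝ × ℝ → ℝ} (hf : ContDiff ℝ ∞ f) (hg : ContDiff ℝ ∞ g) (z : ℝ × ℝ) :
    pdx (fun z ↦ f z * g z) z = pdx f z * g z + f z * pdx g z := by
  have h := ((hf.differentiable (by simp)).differentiableAt.hasFDerivAt (x := z)).fun_mul
    (hg.differentiable (by simp)).differentiableAt.hasFDerivAt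
  rw [pdx, h.fderiv]
  simp [pdx]
  ring

theorem pdt_mul {f g : ℝ × ℝ → ℝ} (hf : ContDiff ℝ ∞ f) (hg : ContDiff ℝ ∞ g) (z : ℝ × ℝ) :
    pdt (fun z ↦ f z * g z) z = pdt f z * g z + f z * pdt g z := by
  have h := ((hf.differentiable (by simp)).differentiableAt.hasFDerivAt (x := z)).fun_mul
    (hg.differentiable (by simp)).differentiableAt.hasFDerivAt
  rw [pdt, h.fderiv]
  simp [pdt]
  ring

theorem pdx_add {f g : ℝ × ℝ → ℝ} (hf : ContDiff ℝ ∞ f) (hg : ContDiff ℝ ∞ g) (z : ℝ × ℝ) :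
    pdx (fun z ↦ f z + g z) z = pdx f z + pdx g z := by
  have h := ((hf.differentiable (by simp)).differentiableAt.hasFDerivAt (x := z)).fun_add
    (hg.differentiable (by simp)).differentiableAt.hasFDerivAt
  rw [pdx, h.fderiv]
  simp [pdx]

theorem pdx_comp_fst {a a' : ℝ → ℝ} (ha : ContDiff ℝ ∞ a) (hd : ∀ x, HasDerivAt a (a' x) x)
    (z : ℝ × ℝ) : pdx (fun z ↦ a z.1) z = a' z.1 :=
  pdx_eq (x := z.1) (t := z.2) (ha.comp contDiff_fst) (hd z.1)

theorem pdt_comp_fst {a : ℝ → ℝ} (ha : ContDiff ℝ ∞ a) (z : ℝ × ℝ) : pdt (fun z ↦ a z.1) z = 0 :=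
  pdt_eq (x := z.1) (t := z.2) (ha.comp contDiff_fst) (hasDerivAt_const z.2 (a z.1))

theorem lineDeriv_fst_apply (φ : Test2) (z : ℝ × ℝ) : (∂_{((1 : ℝ), (0 : ℝ))} φ) z = pdx φ z :=
  lineDeriv_test_apply φ _ z

theorem lineDeriv_snd_apply (φ : Test2) (z : ℝ × ℝ) : (∂_{((0 : ℝ), (1 : ℝ))} φ) z = pdt φ z :=
  lineDeriv_test_apply φ _ z

theorem hasCompactSupport_pdx {W : ℝ × ℝ → ℝ} (hs : HasCompactSupport W) :
    HasCompactSupport (pdx W) := hs.fderiv_apply ℝ _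

theorem hasCompactSupport_pdt {W : ℝ × ℝ → ℝ} (hs : HasCompactSupport W) :
    HasCompactSupport (pdt W) := hs.fderiv_apply ℝ _

/-- The wave operator on `A φ`, by transposition: the weight `A` puts it in divergence form. -/
theorem waveOp_apply {A : ℝ → ℝ} (hA : Admissible A) (u : Dist2) (φ : Test2) :
    waveOp hA u (mulTest _ hA.smooth_fst φ) = u (∂_{((0 : ℝ), (1 : ℝ))} (∂_{((0 : ℝ), (1 : ℝ))}
      (mulTest _ hA.smooth_fst φ)) - ∂_{((1 : ℝ), (0 : ℝ))} (mulTest _ hA.smooth_fst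
        (∂_{((1 : ℝ), (0 : ℝ))} φ))) := by
  have h : mulTest _ hA.smooth_inv_fst (mulTest _ hA.smooth_fst φ) = φ := by
    ext z
    simp only [mulTest_apply]
    rw [← mul_assoc, inv_mul_cancel₀ (hA.pos z.1).ne', one_mul]
  rw [waveOp, sub_apply, mulDist_apply, h, dx_apply, mulDist_apply, dx_apply, dt_apply, dt_apply,
    map_sub]
  ring

/-- Green's identity for the cutoff `θ`, a primitive of an average `ρ`. -/
theorem green_cutoff {A : ℝ → ℝ} (hA : Admissible A) {t₀ b : ℝ} (hb : b < t₀) {u : Dist2}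
    (hwave : Distribution.IsVanishingOn (waveOp hA u) {p : ℝ × ℝ | 0 < p.1})
    (hinit : Distribution.IsVanishingOn u {p : ℝ × ℝ | 0 < p.1 ∧ p.2 < t₀})
    {W : ℝ × ℝ → ℝ} (hW : ContDiff ℝ ∞ W) (hs : HasCompactSupport W)
    (hWeq : ∀ z : ℝ × ℝ, 0 < z.1 → b < z.2 →
      A z.1 * pdt (pdt W) z = pdx (fun z ↦ A z.1 * pdx W z) z)
    {r : ℝ} (hr : 0 < r) (hA1 : ∀ x ≤ 3 * r, A x = 1) {ρ : ℝ → ℝ} (hρ : IsAverage r ρ) :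
    u (mulTest (fun z ↦ ρ z.1) (hρ.smooth.comp contDiff_fst)
        (mkTest _ (contDiff_pdx hW) (hasCompactSupport_pdx hs)))
      = dx u (mulTest (fun z ↦ ρ z.1) (hρ.smooth.comp contDiff_fst) (mkTest W hW hs)) := by
  obtain ⟨θ, hθ, hθd, hθ0⟩ := hρ.exists_primitive hr
  have hθ' : ContDiff ℝ ∞ fun z : ℝ × ℝ ↦ θ z.1 := hθ.comp contDiff_fst
  have hρ' : ContDiff ℝ ∞ fun z : ℝ × ℝ ↦ ρ z.1 := hρ.smooth.comp contDiff_fst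
  have hA' := hA.smooth_fst
  have hWx := contDiff_pdx hW
  have hAWx : ContDiff ℝ ∞ fun z : ℝ × ℝ ↦ A z.1 * pdx W z := hA'.mul hWx
  set G : Test2 := mulTest (fun z ↦ θ z.1) hθ' (mkTest W hW hs) with hG
  have hθz : ∀ z : ℝ × ℝ, θ z.1 ≠ 0 → r ≤ z.1 := fun z hz ↦ by
    by_contra h
    exact hz (hθ0 _ (not_le.1 h))
  have hsub : ∀ φ : Test2, (∀ z, φ z ≠ 0 → r ≤ z.1) →
      tsupport φ ⊆ {p : ℝ × ℝ | r ≤ p.1} := fun φ h ↦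
    closure_minimal h (isClosed_le continuous_const continuous_fst)
  have h0 : waveOp hA u (mulTest _ hA' G) = 0 := by
    refine hwave _ ((hsub _ fun z hz ↦ hθz z ?_).trans fun z hz ↦ lt_of_lt_of_le hr hz)
    intro h
    simp [mulTest_apply, hG, h] at hz
  -- The contribution of the interior vanishes: where `W` is not a solution, `u` vanishes.
  set N : Test2 := mulTest (fun z ↦ θ z.1) hθ'
    (mulTest _ hA' (mkTest _ (contDiff_pdt (contDiff_pdt hW))
        (hasCompactSupport_pdt (hasCompactSupport_pdt hs)))
      - mkTest _ (contDiff_pdx hAWx) (hasCompactSupport_pdx (hasCompactSupport_pdx hs).mul_left))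
    with hN
  have hN0 : u N = 0 := by
    refine hinit _ ?_
    have hcl : IsClosed {p : ℝ × ℝ | r ≤ p.1 ∧ p.2 ≤ b} :=
      (isClosed_le continuous_const continuous_fst).inter
        (isClosed_le continuous_snd continuous_const)
    refine (closure_minimal (fun z hz ↦ ?_) hcl).trans fun z hz ↦
      ⟨lt_of_lt_of_le hr hz.1, lt_of_le_of_lt hz.2 hb⟩
    have hz1 : r ≤ z.1 := hθz z fun h ↦ hz (by simp [hN, mulTest_apply, h])
    refine ⟨hz1, ?_⟩
    by_contra h
    refine hz ?_
    simp only [hN, mulTest_apply, sub_apply, mkTest_apply]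
    rw [hWeq z (lt_of_lt_of_le hr hz1) (not_le.1 h), sub_self, mul_zero]
  have hid : ∂_{((0 : ℝ), (1 : ℝ))} (∂_{((0 : ℝ), (1 : ℝ))} (mulTest _ hA' G))
      - ∂_{((1 : ℝ), (0 : ℝ))} (mulTest _ hA' (∂_{((1 : ℝ), (0 : ℝ))} G))
      = N - mulTest (fun z ↦ ρ z.1) hρ' (mkTest _ hWx (hasCompactSupport_pdx hs))
        - ∂_{((1 : ℝ), (0 : ℝ))} (mulTest (fun z ↦ ρ z.1) hρ' (mkTest W hW hs)) := by
    have e1 : ⇑(mulTest _ hA' G) = fun z ↦ (A z.1 * θ z.1) * W z := by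
      funext z; simp only [mulTest_apply, hG, mkTest_apply]; ring
    have hAθ : ContDiff ℝ ∞ fun x ↦ A x * θ x := hA.smooth.mul hθ
    have hAθ' : ContDiff ℝ ∞ fun z : ℝ × ℝ ↦ A z.1 * θ z.1 := hA'.mul hθ'
    have e2 : ⇑(∂_{((0 : ℝ), (1 : ℝ))} (mulTest _ hA' G) : Test2)
        = fun z ↦ (A z.1 * θ z.1) * pdt W z := by
      funext z
      rw [lineDeriv_snd_apply, e1, pdt_mul hAθ' hW, pdt_comp_fst hAθ, zero_mul, zero_add]
    have hρA : ∀ x, A x * ρ x = ρ x := fun x ↦ by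
      by_cases hx : x ∈ Set.Icc r (3 * r)
      · rw [hA1 x hx.2, one_mul]
      · rw [hρ.zero x hx, mul_zero]
    have e3 : ⇑(mulTest _ hA' (∂_{((1 : ℝ), (0 : ℝ))} G : Test2))
        = fun z ↦ ρ z.1 * W z + θ z.1 * (A z.1 * pdx W z) := by
      funext z
      have eG : ⇑G = fun z ↦ θ z.1 * W z := rfl
      rw [mulTest_apply, lineDeriv_fst_apply, eG, pdx_mul hθ' hW, pdx_comp_fst hθ hθd]
      linear_combination W z * hρA z.1
    ext z
    simp only [sub_apply, hN, mulTest_apply, mkTest_apply]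
    rw [lineDeriv_snd_apply, lineDeriv_fst_apply, lineDeriv_fst_apply, e2, e3,
      pdt_mul hAθ' (contDiff_pdt hW), pdt_comp_fst hAθ, pdx_add (hρ'.mul hW) (hθ'.mul hAWx),
      pdx_mul hθ' hAWx, pdx_comp_fst hθ hθd]
    have e4 : ⇑(mulTest (fun z ↦ ρ z.1) hρ' (mkTest W hW hs)) = fun z ↦ ρ z.1 * W z := rfl
    rw [e4]
    linear_combination (-pdx W z) * hρA z.1
  rw [waveOp_apply, hid, map_sub, map_sub, hN0] at h0
  rw [dx_apply]
  linear_combination -h0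

/-- Green's identity on the half plane `x > 0`, between a distributional solution and a test
function solving the wave equation on the support of `u`. -/
theorem IsNeumannSolution.green {A : ℝ → ℝ} {hA : Admissible A} {t₀ b : ℝ} (hb : b < t₀) {u : Dist2}
    {f g : Dist1} (hu : IsNeumannSolution hA t₀ f u) (hg : IsBoundaryTrace u g)
    {W : ℝ × ℝ → ℝ} (hW : ContDiff ℝ ∞ W) (hs : HasCompactSupport W)
    (hWeq : ∀ z : ℝ × ℝ, 0 < z.1 → b < z.2 →
      A z.1 * pdt (pdt W) z = pdx (fun z ↦ A z.1 * pdx W z) z) :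
    g (slice (mkTest _ (contDiff_pdx hW) (hasCompactSupport_pdx hs)))
      = f (slice (mkTest W hW hs)) := by
  obtain ⟨δ, hδ, hA1⟩ := hA.exists_pos_eq_one
  let r : ℕ → ℝ := fun n ↦ δ / 4 / (n + 1)
  have hr : ∀ n, 0 < r n := fun n ↦ by positivity
  have hr0 : Tendsto r atTop (𝓝 0) := by
    simpa [r, div_eq_mul_inv] using
      (tendsto_one_div_add_atTop_nhds_zero_nat (𝕜 := ℝ)).const_mul (δ / 4)
  have hrδ : ∀ n, 3 * r n < δ := fun n ↦ by
    have : r n ≤ δ / 4 := div_le_self (by positivity) (by linarith [n.cast_nonneg (α := ℝ)])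
    linarith
  choose ρ hρ using fun n ↦ exists_isAverage (hr n)
  have h1 := hg.tendsto_average hr hr0 hρ (mkTest _ (contDiff_pdx hW) (hasCompactSupport_pdx hs))
  have h2 := hu.neumann.tendsto_average hr hr0 hρ (mkTest W hW hs)
  refine tendsto_nhds_unique h1 (h2.congr fun n ↦ ?_)
  exact (green_cutoff hA hb hu.wave hu.initial hW hs hWeq (hr n)
    (fun x hx ↦ hA1 x (hx.trans_lt (hrδ n))) (hρ n)).symm

/-! ### Time reversal and cutoff -/

theorem fderiv_reverse {u : ℝ × ℝ → ℝ} (hu : ContDiff ℝ ∞ u) (z v : ℝ × ℝ) :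
    fderiv ℝ (fun z : ℝ × ℝ ↦ u (z.1, -z.2)) z v = fderiv ℝ u (z.1, -z.2) (v.1, -v.2) := by
  have h1 := (hu.differentiable (by simp)).differentiableAt.hasFDerivAt (x := (z.1, -z.2))
  have h2 : HasFDerivAt (fun z : ℝ × ℝ ↦ (z.1, -z.2)) _ z :=
    hasFDerivAt_fst.prodMk (hasFDerivAt_snd (𝕜 := ℝ) (p := z)).fun_neg
  have h3 : fderiv ℝ (fun z : ℝ × ℝ ↦ u (z.1, -z.2)) z = _ := (h1.comp z h2).fderiv
  rw [h3]
  simp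

theorem pdx_reverse {u : ℝ × ℝ → ℝ} (hu : ContDiff ℝ ∞ u) :
    pdx (fun z : ℝ × ℝ ↦ u (z.1, -z.2)) = fun z ↦ pdx u (z.1, -z.2) := by
  funext z
  rw [pdx, fderiv_reverse hu]
  simp [pdx]

theorem pdt_reverse {u : ℝ × ℝ → ℝ} (hu : ContDiff ℝ ∞ u) :
    pdt (fun z : ℝ × ℝ ↦ u (z.1, -z.2)) = fun z ↦ -pdt u (z.1, -z.2) := by
  funext z
  rw [pdt, fderiv_reverse hu, pdt, ← map_neg]
  simp

theorem pdt_neg (u : ℝ × ℝ → ℝ) (z : ℝ × ℝ) : pdt (fun z ↦ -u z) z = -pdt u z := by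
  rw [pdt, fderiv_fun_neg]
  rfl

theorem IsWave.reverse {A : ℝ → ℝ} (hA : Admissible A) {u : ℝ × ℝ → ℝ} (hu : IsWave A u) :
    IsWave A fun z ↦ u (z.1, -z.2) := by
  refine ⟨hu.smooth.comp (contDiff_fst.prodMk contDiff_snd.neg), fun z ↦ ?_⟩
  have h1 : ContDiff ℝ ∞ fun z : ℝ × ℝ ↦ A z.1 * pdx u z :=
    hA.smooth_fst.mul (contDiff_pdx hu.smooth)
  have h2 := congrFun (pdx_reverse h1) z
  simp only at h2
  rw [pdt_reverse hu.smooth, pdt_neg, pdt_reverse (contDiff_pdt hu.smooth), neg_neg,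
    pdx_reverse hu.smooth, h2]
  exact hu.eq (z.1, -z.2)

/-- A smooth cutoff in both variables, equal to `1` on `{x ≥ -1, t ≥ b - 1}`. -/
noncomputable def cutoff (b : ℝ) (z : ℝ × ℝ) : ℝ :=
  Real.smoothTransition (z.1 + 2) * Real.smoothTransition (z.2 - b + 2)

theorem contDiff_cutoff (b : ℝ) : ContDiff ℝ ∞ (cutoff b) :=
  (Real.smoothTransition.contDiff.comp (contDiff_fst.add contDiff_const)).mul
    (Real.smoothTransition.contDiff.comp ((contDiff_snd.sub contDiff_const).add contDiff_const))

theorem cutoff_eq_one {b : ℝ} {z : ℝ × ℝ} (h₁ : -1 ≤ z.1) (h₂ : b - 1 ≤ z.2) : cutoff b z = 1 := by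
  rw [cutoff, Real.smoothTransition.one_of_one_le (by linarith),
    Real.smoothTransition.one_of_one_le (by linarith), one_mul]

theorem cutoff_ne_zero {b : ℝ} {z : ℝ × ℝ} (h : cutoff b z ≠ 0) : -2 ≤ z.1 ∧ b - 2 ≤ z.2 := by
  rw [cutoff, mul_ne_zero_iff] at h
  simp only [ne_eq, Real.smoothTransition.zero_iff_nonpos, not_le] at h
  exact ⟨by linarith [h.1], by linarith [h.2]⟩

/-- A solution vanishing for `x + t > T` becomes compactly supported under the cutoff. -/
theorem hasCompactSupport_cutoff_mul {b T : ℝ} {w : ℝ × ℝ → ℝ}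
    (hw : ∀ x t, T < x + t → w (x, t) = 0) : HasCompactSupport fun z ↦ cutoff b z * w z := by
  refine HasCompactSupport.intro ((isCompact_Icc (a := (-2 : ℝ)) (b := T - b + 2)).prod
    (isCompact_Icc (a := b - 2) (b := T + 2))) fun z hz ↦ ?_
  by_contra h
  obtain ⟨h1, h2⟩ := mul_ne_zero_iff.1 h
  obtain ⟨h3, h4⟩ := cutoff_ne_zero h1
  have h5 : z.1 + z.2 ≤ T := by
    by_contra h5
    exact h2 (hw z.1 z.2 (not_le.1 h5))
  exact hz ⟨⟨h3, by linarith⟩, ⟨h4, by linarith⟩⟩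

theorem cutoff_mul_eventuallyEq {b : ℝ} (w : ℝ × ℝ → ℝ) {z : ℝ × ℝ} (h₁ : -1 < z.1)
    (h₂ : b - 1 < z.2) : (fun z ↦ cutoff b z * w z) =ᶠ[𝓝 z] w := by
  filter_upwards [(isOpen_Ioi.prod isOpen_Ioi).mem_nhds
    (show z ∈ Set.Ioi (-1 : ℝ) ×ˢ Set.Ioi (b - 1) from ⟨h₁, h₂⟩)] with y hy
  rw [cutoff_eq_one (le_of_lt hy.1) (le_of_lt hy.2), one_mul]

theorem eventuallyEq_pdx {v w : ℝ × ℝ → ℝ} {z : ℝ × ℝ} (h : v =ᶠ[𝓝 z] w) :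
    pdx v =ᶠ[𝓝 z] pdx w := by
  filter_upwards [h.fderiv (𝕜 := ℝ)] with y hy
  rw [pdx, hy, pdx]

theorem eventuallyEq_pdt {v w : ℝ × ℝ → ℝ} {z : ℝ × ℝ} (h : v =ᶠ[𝓝 z] w) :
    pdt v =ᶠ[𝓝 z] pdt w := by
  filter_upwards [h.fderiv (𝕜 := ℝ)] with y hy
  rw [pdt, hy, pdt]

/-- The duality between the Dirichlet data of a distributional solution and the Neumann data of a
smooth solution of the time-reversed problem. -/
theorem IsNDPair.pairing {A : ℝ → ℝ} {hA : Admissible A} {f₀ : ℝ → ℝ} (hf : ContDiff ℝ ∞ f₀)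
    (hfs : HasCompactSupport f₀) {g : Dist1} (h : IsNDPair hA (ofFun fun t ↦ (f₀ t : ℂ)) g)
    {w : ℝ × ℝ → ℝ} (hw : IsWave A w) {T : ℝ} (hT : ∀ x t, T < x + t → w (x, t) = 0)
    {k : ℝ → ℝ} (hk : ContDiff ℝ ∞ k) (hks : HasCompactSupport k)
    (hwk : ∀ t, pdx w (0, t) = k t) :
    g (mkTest k hk hks) = ∫ t, w (0, t) • (f₀ t : ℂ) := by
  obtain ⟨t₀, u, -, hu, hg⟩ := h
  obtain ⟨a, ha⟩ := hks.isCompact.bddBelow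
  obtain ⟨a', ha'⟩ := hfs.isCompact.bddBelow
  -- The cutoff time lies before the supports of the boundary data and before `t₀`.
  set b := min (min a a') t₀
  have hba : b ≤ a := (min_le_left _ _).trans (min_le_left _ _)
  have hba' : b ≤ a' := (min_le_left _ _).trans (min_le_right _ _)
  have hbt : b - 1 < t₀ := by have := min_le_right (min a a') t₀; simp only [b]; linarith
  have hW : ContDiff ℝ ∞ fun z ↦ cutoff b z * w z := (contDiff_cutoff b).mul hw.smooth
  have hWs := hasCompactSupport_cutoff_mul (b := b) hT
  have key := hu.green hbt hg hW hWs fun z hz1 hz2 ↦ by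
    have e := cutoff_mul_eventuallyEq (b := b) w (z := z) (by linarith) hz2
    have e1 := (eventuallyEq_pdt (eventuallyEq_pdt e)).eq_of_nhds
    have e2 : (fun z ↦ A z.1 * pdx (fun z ↦ cutoff b z * w z) z)
        =ᶠ[𝓝 z] fun z ↦ A z.1 * pdx w z := by
      filter_upwards [eventuallyEq_pdx e] with y hy
      rw [hy]
    rw [e1, (eventuallyEq_pdx e2).eq_of_nhds]
    exact hw.eq z
  have hx : ∀ t, pdx (fun z ↦ cutoff b z * w z) (0, t)
      = Real.smoothTransition (t - b + 2) * pdx w (0, t) := by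
    intro t
    have e : pdx (cutoff b) (0, t) = 0 := by
      refine pdx_eq (contDiff_cutoff b) ?_
      refine (hasDerivAt_const (0 : ℝ) (cutoff b (0, t))).congr_of_eventuallyEq ?_
      filter_upwards [Ioi_mem_nhds (show (-1 : ℝ) < 0 by norm_num)] with x hx
      have hx' : -1 < x := hx
      simp only [cutoff]
      rw [Real.smoothTransition.one_of_one_le (show 1 ≤ x + 2 by linarith),
        Real.smoothTransition.one_of_one_le (show (1 : ℝ) ≤ 0 + 2 by norm_num)]
    rw [pdx_mul (contDiff_cutoff b) hw.smooth, e, zero_mul, zero_add, cutoff]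
    simp only
    rw [Real.smoothTransition.one_of_one_le (by norm_num), one_mul]
  have e1 : slice (mkTest _ (contDiff_pdx hW) (hasCompactSupport_pdx hWs)) = mkTest k hk hks := by
    ext t
    rw [slice_apply, mkTest_apply, mkTest_apply, hx, hwk]
    by_cases ht : k t = 0
    · rw [ht, mul_zero]
    · have := ha (subset_tsupport _ ht)
      rw [Real.smoothTransition.one_of_one_le (by linarith), one_mul]
  rw [e1] at key
  rw [key, ofFun_apply (contDiff_complex hf).continuous]
  refine integral_congr_ae (.of_forall fun t ↦ ?_)
  simp only [slice_apply, mkTest_apply]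
  by_cases ht : f₀ t = 0
  · simp [ht]
  · have := ha' (subset_tsupport _ ht)
    rw [cutoff_eq_one (by norm_num) (by simp only; linarith), one_mul]

theorem exists_isSource_of_hasCompactSupport {f : ℝ → ℝ} (hf : ContDiff ℝ ∞ f)
    (hs : HasCompactSupport f) : ∃ t₀, IsSource t₀ f := by
  obtain ⟨a, ha⟩ := hs.isCompact.bddBelow
  refine ⟨a, hf, fun t ht ↦ ?_⟩
  by_contra h
  exact absurd (ha (subset_tsupport _ h)) (not_le.2 ht)

theorem IsSource.exists_primitive {t₀ : ℝ} {f : ℝ → ℝ} (hf : IsSource t₀ f) :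
    ∃ F, IsSource t₀ F ∧ _root_.deriv F = f := by
  have hc := hf.smooth.continuous
  have hd : ∀ x, HasDerivAt (fun x ↦ ∫ y in t₀..x, f y) (f x) x := fun x ↦
    intervalIntegral.integral_hasDerivAt_right (hc.intervalIntegrable _ _)
      hc.aestronglyMeasurable.stronglyMeasurableAtFilter hc.continuousAt
  have hde : _root_.deriv (fun x ↦ ∫ y in t₀..x, f y) = f := funext fun x ↦ (hd x).deriv
  refine ⟨fun x ↦ ∫ y in t₀..x, f y, ⟨?_, fun t ht ↦ ?_⟩, hde⟩
  · rw [contDiff_infty_iff_deriv, hde]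
    exact ⟨fun x ↦ (hd x).differentiableAt, hf.smooth⟩
  · have h0 : ∀ y ∈ Set.uIoc t t₀, f y = 0 ∨ y = t₀ := fun y hy ↦ by
      rw [Set.uIoc_of_le ht.le] at hy
      rcases hy.2.lt_or_eq with h | h
      exacts [.inl (hf.zero y h), .inr h]
    rw [intervalIntegral.integral_symm, neg_eq_zero,
      ← intervalIntegral.integral_zero (a := t) (b := t₀) (μ := volume) (E := ℝ)]
    refine intervalIntegral.integral_congr_ae ?_
    filter_upwards [compl_mem_ae_iff.2 (measure_singleton t₀)] with y hy hy'
    exact (h0 y hy').resolve_right hy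

/-- The Neumann-to-Dirichlet map determines the boundary response to all smooth sources. -/
theorem response_eq {A₁ A₂ : ℝ → ℝ} (hA₁ : Admissible A₁) (hA₂ : Admissible A₂)
    (h : Set.EqOn (neumannToDirichlet hA₁) (neumannToDirichlet hA₂) compactlySupported)
    {P₁ R₁ P₂ R₂ : ℝ → ℝ → ℝ} (hK₁ : IsKernel (logCoeff A₁) P₁ R₁)
    (hK₂ : IsKernel (logCoeff A₂) P₂ R₂) {F : ℝ → ℝ} (hF : ContDiff ℝ ∞ F)
    (hFs : HasCompactSupport F) (t : ℝ) : causalConv R₁ F 0 t = causalConv R₂ F 0 t := by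
  obtain ⟨t₀, hFt⟩ := exists_isSource_of_hasCompactSupport hF hFs
  have hcont : ∀ {R : ℝ → ℝ → ℝ}, Continuous (Function.uncurry R) →
      Continuous fun t ↦ 2 * causalConv R F 0 (-t) - F (-t) := fun hR ↦
    (continuous_const.mul ((continuous_causalConv hFt hR).comp
      (f := fun t : ℝ ↦ ((0 : ℝ), -t)) (by fun_prop))).sub (hF.continuous.comp continuous_neg)
  have hd : ContDiff ℝ ∞ fun t ↦ deriv F (-t) := hFt.deriv.smooth.comp contDiff_neg
  have hds : HasCompactSupport fun t ↦ deriv F (-t) :=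
    hFs.deriv.comp_homeomorph (Homeomorph.neg ℝ)
  -- For Neumann data `f` both maps have a common value, which is tested with `F'(-t)`, the Neumann
  -- data of the time-reversed smooth solution.
  have hpair : ∀ f : ℝ → ℝ, ContDiff ℝ ∞ f → HasCompactSupport f →
      ∫ t, f t • (2 * causalConv R₁ F 0 (-t) - F (-t))
        = ∫ t, f t • (2 * causalConv R₂ F 0 (-t) - F (-t)) := by
    intro f hf hfs
    obtain ⟨s₀, hfsrc⟩ := exists_isSource_of_hasCompactSupport hf hfs
    obtain ⟨F₀, hF₀, hF₀'⟩ := hfsrc.exists_primitive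
    have hmem : ofFun (fun t ↦ (f t : ℂ)) ∈ compactlySupported :=
      (hfs.comp_left (g := ((↑) : ℝ → ℂ)) Complex.ofReal_zero).isCompact.of_isClosed_subset
        Distribution.isClosed_dsupport (dsupport_ofFun_subset (contDiff_complex hf).continuous)
    have hside : ∀ {A : ℝ → ℝ} (hA : Admissible A) {P R : ℝ → ℝ → ℝ},
        IsKernel (logCoeff A) P R →
        neumannToDirichlet hA (ofFun fun t ↦ (f t : ℂ)) (mkTest _ hd hds)
          = ((∫ t, f t • (2 * causalConv R F 0 (-t) - F (-t)) : ℝ) : ℂ) := by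
      intro A hA P R hK
      obtain ⟨u₀, hu₀, hN₀, h0₀, -⟩ := hA.exists_isWave hK hF₀
      rw [hF₀'] at hN₀
      have hp := isNDPair_neumannToDirichlet hA ⟨_, hu₀.isNDPair hA hfsrc hN₀ h0₀⟩
      obtain ⟨u, hu, hN, h0, hD⟩ := hA.exists_isWave hK hFt
      rw [hp.pairing hf hfs (hu.reverse hA) (T := -t₀) (fun x t ht ↦ h0 _ _ (by linarith)) hd hds
        fun t ↦ by rw [pdx_reverse hu.smooth]; exact hN (-t), ← integral_complex_ofReal]
      refine integral_congr_ae (.of_forall fun t ↦ ?_)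
      simp only [hD, Complex.real_smul, smul_eq_mul]
      push_cast
      ring
    have := (hside hA₁ hK₁).symm.trans ((congrArg (fun v : Dist1 ↦ v _) (h hmem)).trans
      (hside hA₂ hK₂))
    exact_mod_cast this
  have hae := ae_eq_of_integral_contDiff_smul_eq (hcont hK₁.cont_R).locallyIntegrable
    (hcont hK₂.cont_R).locallyIntegrable hpair
  have heq := congrFun (((hcont hK₁.cont_R).ae_eq_iff_eq volume (hcont hK₂.cont_R)).1 hae) (-t)
  simp only [neg_neg] at heq
  linarith

/-- The Neumann-to-Dirichlet map determines the boundary values `R(0, ·)` of the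
impulse response. -/
theorem kernel_boundary_eq {A₁ A₂ : ℝ → ℝ} (hA₁ : Admissible A₁) (hA₂ : Admissible A₂)
    (h : Set.EqOn (neumannToDirichlet hA₁) (neumannToDirichlet hA₂) compactlySupported)
    {P₁ R₁ P₂ R₂ : ℝ → ℝ → ℝ} (hK₁ : IsKernel (logCoeff A₁) P₁ R₁)
    (hK₂ : IsKernel (logCoeff A₂) P₂ R₂) {τ : ℝ} (hτ : 0 ≤ τ) : R₁ 0 τ = R₂ 0 τ := by
  have hc₁ : Continuous (R₁ 0) := hK₁.cont_R.uncurry_left 0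
  have hc₂ : Continuous (R₂ 0) := hK₂.cont_R.uncurry_left 0
  have hae : ∀ᵐ s, s ∈ Set.Ioi (0 : ℝ) → R₁ 0 s - R₂ 0 s = 0 := by
    refine isOpen_Ioi.ae_eq_zero_of_integral_contDiff_smul_eq_zero
      ((hc₁.fun_sub hc₂).locallyIntegrable.locallyIntegrableOn _) fun g hg hgs hgt ↦ ?_
    have h0 := response_eq hA₁ hA₂ h hK₁ hK₂ (F := fun t ↦ g (-t)) (hg.comp contDiff_neg)
      (hgs.comp_homeomorph (Homeomorph.neg ℝ)) 0
    have hset : ∀ R : ℝ → ℝ → ℝ, causalConv R (fun t ↦ g (-t)) 0 0 = ∫ s, g s * R 0 s := by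
      intro R
      simp only [causalConv, zero_sub, neg_neg]
      rw [setIntegral_eq_integral_of_forall_compl_eq_zero fun s hs ↦ ?_]
      · simp_rw [mul_comm]
      · rw [image_eq_zero_of_notMem_tsupport fun h ↦ hs (hgt h), mul_zero]
    rw [hset, hset] at h0
    have hi : ∀ {e : ℝ → ℝ}, Continuous e → Integrable fun s ↦ g s * e s := fun he ↦
      (hg.continuous.mul he).integrable_of_hasCompactSupport hgs.mul_right
    simp only [smul_eq_mul, mul_sub]
    rw [integral_sub (hi hc₁) (hi hc₂), h0, sub_self]
  have hres : R₁ 0 =ᵐ[volume.restrict (Set.Ici 0)] R₂ 0 := by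
    rw [← restrict_Ioi_eq_restrict_Ici]
    filter_upwards [(ae_restrict_iff' measurableSet_Ioi).2 hae] with s hs using sub_eq_zero.1 hs
  exact Measure.eqOn_of_ae_eq hres hc₁.continuousOn hc₂.continuousOn (by simp) hτ

theorem Admissible.logCoeff_eq_zero {A : ℝ → ℝ} (hA : Admissible A) {x : ℝ} (hx : x ≤ 0) :
    logCoeff A x = 0 := by
  obtain ⟨δ, hδ, h1⟩ := hA.exists_pos_eq_one
  have : A =ᶠ[𝓝 x] fun _ ↦ 1 := by
    filter_upwards [Iio_mem_nhds (hx.trans_lt hδ)] with y hy using h1 y hy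
  rw [logCoeff, this.deriv_eq, deriv_const, zero_div]

/-- The quotient of two coefficients with equal logarithmic derivatives is constant, and equals `1`
at `x = 0`. -/
theorem Admissible.eq_of_logCoeff_eq {A₁ A₂ : ℝ → ℝ} (hA₁ : Admissible A₁) (hA₂ : Admissible A₂)
    (h : ∀ x, logCoeff A₁ x = logCoeff A₂ x) : A₁ = A₂ := by
  have hd : ∀ x, HasDerivAt (fun x ↦ A₁ x / A₂ x) 0 x := by
    intro x
    refine ((hA₁.hasDerivAt x).fun_div (hA₂.hasDerivAt x) (hA₂.pos x).ne').congr_deriv ?_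
    have h1 := (hA₁.pos x).ne'
    have h2 := (hA₂.pos x).ne'
    have hx := h x
    rw [logCoeff, logCoeff, div_eq_div_iff (by positivity) (by positivity)] at hx
    rw [div_eq_zero_iff]
    left
    linarith
  funext x
  have := is_const_of_deriv_eq_zero (fun x ↦ (hd x).differentiableAt) (fun x ↦ (hd x).deriv) x 0
  simp only [hA₁.apply_zero, hA₂.apply_zero, div_one] at this
  exact (div_eq_one_iff_eq (hA₂.pos x).ne').1 this

end WaveND

theorem theoremB2 (A₁ A₂ : ℝ → ℝ) (hA₁ : WaveND.Admissible A₁) (hA₂ : WaveND.Admissible A₂)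
    (h : Set.EqOn (WaveND.neumannToDirichlet hA₁) (WaveND.neumannToDirichlet hA₂)
      WaveND.compactlySupported) :
    A₁ = A₂ := by
  have hc₁ := hA₁.contDiff_logCoeff.continuous
  have hc₂ := hA₂.contDiff_logCoeff.continuous
  obtain ⟨P₁, R₁, hK₁⟩ := WaveND.exists_isKernel hc₁ hA₁.hasCompactSupport_logCoeff
  obtain ⟨P₂, R₂, hK₂⟩ := WaveND.exists_isKernel hc₂ hA₂.hasCompactSupport_logCoeff
  refine hA₁.eq_of_logCoeff_eq hA₂ fun x ↦ ?_
  rcases le_total x 0 with hx | hx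
  · rw [hA₁.logCoeff_eq_zero hx, hA₂.logCoeff_eq_zero hx]
  · exact hK₁.coeff_eq hK₂ hc₁ hc₂ (fun τ hτ ↦ WaveND.kernel_boundary_eq hA₁ hA₂ h hK₁ hK₂ hτ) hx
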